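/- Let $\mathsf C$ be a symmetric monoidal category with unit $K$ and symmetry $c$ (associativity and unit constraints are suppressed). Let $H=(H,\eta_H,\mu_H,\varepsilon_H,\delta_H,\lambda_H)$ be a Hopf algebra in $\mathsf C$ that is commutative, $\mu_H\circ c_{H,H}=\mu_H$, and finite: there are an object $H^*$ and morphisms $a\colon K\to H^*\otimes H$, $b\colon H\otimes H^*\to K$ with $(b\otimes H)\circ(H\otimes a)=id_H$ and $(H^*\otimes b)\circ(a\otimes H^*)=id_{H^*}$. The antipode $\lambda_H$ is then invertible. An object is also used to denote its identity morphism. Let $\widehat H=(H^{cop})^*$ be the object $H^*$ with $$\eta_{\widehat H}=(H^*\otimes\varepsilon_H)\circ a,\qquad \varepsilon_{\widehat H}=b\circ(\eta_H\otimes H^*),\qquad \lambda_{\widehat H}=(H^*\otimes b)\circ(H^*\otimes\lambda_H^{-1}\otimes H^*)\circ(a\otimes H^*),$$ $$\mu_{\widehat H}=(H^*\otimes b)\circ(H^*\otimes H\otimes b\otimes H^*)\circ(((H^*\otimes(c_{H,H}\circ\delta_H))\circ a)\otimes H^*\otimes H^*),$$ $$\delta_{\widehat H}=(H^*\otimes H^*\otimes(b\circ(\mu_H\otimes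 H^*)))\circ(((H^*\otimes a\otimes H)\circ a)\otimes H^*).$$ Put $$R=\mu_H\circ c_{H,H}\circ(\mu_H\otimes\lambda_H^{-1})\circ(H\otimes\delta_H),\qquad \overline R=(H\otimes(\mu_H\circ(\lambda_H^{-1}\otimes H)))\circ(\delta_H\otimes H)\circ c_{H,H}\circ\delta_H,$$ $$\varphi=(H^*\otimes b)\circ(H^*\otimes R\otimes H^*)\circ(a\otimes H\otimes H^*)\colon H\otimes H^*\to H^*,\qquad \phi=(H\otimes b)\circ(\overline R\otimes H^*)\colon H\otimes H^*\to H,$$ $$\Psi=(\varphi\otimes\phi)\circ(H\otimes c_{H,H^*}\otimes H^*)\circ(\delta_H\otimes\delta_{\widehat H}).$$ Let $T(H)=\widehat H\otimes H$ be the tensor product Hopf algebra: its unit, counit and antipode are $\eta_{\widehat H}\otimes\eta_H$, $\varepsilon_{\widehat H}\otimes\varepsilon_H$, $\lambda_{\widehat H}\otimes\lambda_H$, its product is $(\mu_{\widehat H}\otimes\mu_H)\circ(H^*\otimes c_{H,H^*}\otimes H)$ and its coproduct is $(H^*\otimes c_{H^*,H}\otimes H)\circ(\delta_{\widehat H}\otimes\delta_H)$.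 Let $D(H)=\widehat H\bowtie H$ be the Drinfeld double: it has the unit, counit and coproduct of $T(H)$, the product $(\mu_{\widehat H}\otimes\mu_H)\circ(H^*\otimes\Psi\otimes H)$ and the antipode $\Psi\circ(\lambda_H\otimes\lambda_{\widehat H})\circ c_{H^*,H}$. Then $(D(H),T(H))$ is a Hopf brace in $\mathsf C$. That is, writing $X=H^*\otimes H$, with $\mu^1,\lambda^1$ the product and antipode of $D(H)$, $\mu^2$ the product of $T(H)$ and $\delta$ their common coproduct: $D(H)$ and $T(H)$ are Hopf algebras in $\mathsf C$ on $X$ with the same counit and coproduct, and $$\mu^2\circ(X\otimes\mu^1)=\mu^1\circ(\mu^2\otimes\Gamma)\circ(X\otimes c_{X,X}\otimes X)\circ(\delta\otimes X\otimes X),\qquad \Gamma=\mu^1\circ(\lambda^1\otimes\mu^2)\circ(\delta\otimes X).$$ -/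

import Mathlib

open CategoryTheory MonoidalCategory
open scoped MonObj ComonObj HopfObj

universe v u

namespace HopfBraces

/-- The five structure morphisms `(η, μ, ε, δ, λ)` on an object `X`, without any law.
The laws are imposed by `HopfData.IsHopf`. -/
@[ext]
structure HopfData {C : Type u} [Category.{v} C] [MonoidalCategory C] (X : C) where
  /-- unit -/
  one : 𝟙_ C ⟶ X
  /-- product -/
  mul : X ⊗ X ⟶ X
  /-- counit -/
  counit : X ⟶ 𝟙_ C
  /-- coproduct -/
  comul : X ⟶ X ⊗ X
  /-- antipode -/
  antipode : X ⟶ X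

section

variable {C : Type u} [Category.{v} C] [MonoidalCategory C] [SymmetricCategory C]

/-- The structure morphisms of a Hopf algebra in `C`. -/
def HopfData.ofHopfObj {X : C} (h : HopfObj X) : HopfData X where
  one := h.one
  mul := h.mul
  counit := h.counit
  comul := h.comul
  antipode := h.antipode

/-- `A` is a Hopf algebra in `C`: its morphisms are those of a Hopf object in Mathlib's sense. -/
def HopfData.IsHopf {X : C} (A : HopfData X) : Prop :=
  ∃ h : HopfObj X, HopfData.ofHopfObj h = A

/-- `Γ = μ₁ ∘ (λ₁ ⊗ μ₂) ∘ (δ ⊗ X)`. -/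
def braceGamma {X : C} (A₁ A₂ : HopfData X) : X ⊗ X ⟶ X :=
  A₁.comul ▷ X ≫ (α_ X X X).hom ≫ (A₁.antipode ⊗ₘ A₂.mul) ≫ A₁.mul

/-- The pair `(A₁, A₂)` is a Hopf brace in `C`: two Hopf algebras on the same object with the same
underlying coalgebra, such that
`μ₂ ∘ (X ⊗ μ₁) = μ₁ ∘ (μ₂ ⊗ Γ) ∘ (X ⊗ c ⊗ X) ∘ (δ ⊗ X ⊗ X)`. -/
structure IsHopfBrace {X : C} (A₁ A₂ : HopfData X) : Prop where
  isHopf_fst : A₁.IsHopf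
  isHopf_snd : A₂.IsHopf
  counit_eq : A₁.counit = A₂.counit
  comul_eq : A₁.comul = A₂.comul
  compat : X ◁ A₁.mul ≫ A₂.mul =
    A₁.comul ▷ (X ⊗ X) ≫ tensorμ X X X X ≫ (A₂.mul ⊗ₘ braceGamma A₁ A₂) ≫ A₁.mul

/-- The tensor product `A ⊗ B` of Hopf algebras. -/
def HopfData.tensor {X Y : C} (A : HopfData X) (B : HopfData Y) : HopfData (X ⊗ Y) where
  one := (λ_ (𝟙_ C)).inv ≫ (A.one ⊗ₘ B.one)
  mul := tensorμ X Y X Y ≫ (A.mul ⊗ₘ B.mul)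
  counit := (A.counit ⊗ₘ B.counit) ≫ (λ_ (𝟙_ C)).hom
  comul := (A.comul ⊗ₘ B.comul) ≫ tensorμ X X Y Y
  antipode := A.antipode ⊗ₘ B.antipode

/-- `Ψ = (φ ⊗ ψ) ∘ (Y ⊗ c ⊗ X) ∘ (δ_B ⊗ δ_A)`, for `φ : B ⊗ A ⟶ A` and `ψ : B ⊗ A ⟶ B`. -/
def bicrossedPsi {X Y : C} (A : HopfData X) (B : HopfData Y) (φ : Y ⊗ X ⟶ X) (ψ : Y ⊗ X ⟶ Y) :
    Y ⊗ X ⟶ X ⊗ Y :=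
  (B.comul ⊗ₘ A.comul) ≫ tensorμ Y Y X X ≫ (φ ⊗ₘ ψ)

/-- The bicrossed product `A ⋈ B` for a left action `φ` of `B` on `A` and a right action `ψ` of
`A` on `B`: unit, counit and coproduct are those of `A ⊗ B`, the product is
`(μ_A ⊗ μ_B) ∘ (A ⊗ Ψ ⊗ B)` and the antipode is `Ψ ∘ (λ_B ⊗ λ_A) ∘ c`. -/
def HopfData.bicrossed {X Y : C} (A : HopfData X) (B : HopfData Y)
    (φ : Y ⊗ X ⟶ X) (ψ : Y ⊗ X ⟶ Y) : HopfData (X ⊗ Y) where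
  one := (A.tensor B).one
  mul := 𝟙 _ ⊗≫ X ◁ (bicrossedPsi A B φ ψ) ▷ Y ⊗≫ (A.mul ⊗ₘ B.mul)
  counit := (A.tensor B).counit
  comul := (A.tensor B).comul
  antipode := (β_ X Y).hom ≫ (B.antipode ⊗ₘ A.antipode) ≫ bicrossedPsi A B φ ψ

/-- The antipode of a commutative Hopf algebra is invertible (it is its own inverse). -/
instance isIso_antipode (H : C) [HopfObj H] [IsCommMonObj H] : IsIso 𝒮[H] :=
  ⟨𝒮[H], HopfObj.antipode_antipode H (IsCommMonObj.mul_comm H),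
    HopfObj.antipode_antipode H (IsCommMonObj.mul_comm H)⟩

section Double

/- `H` is a Hopf algebra with invertible antipode. The pairing `ExactPairing Hd H` says that `H` is
finite with dual `Hd = H*`: it consists of `a : 𝟙 ⟶ H* ⊗ H` (coevaluation) and
`b : H ⊗ H* ⟶ 𝟙` (evaluation) with the triangle identities, which is the same as an adjunction
`H ⊗ - ⊣ H* ⊗ -` with unit `a ⊗ -` and counit `b ⊗ -`. -/
variable (H Hd : C) [HopfObj H] [IsIso 𝒮[H]] [ExactPairing Hd H]

/-- The Hopf algebra `(H^cop)*`, on the object `H*`. -/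
noncomputable def dualCop : HopfData Hd where
  one := ExactPairing.coevaluation Hd H ≫ Hd ◁ ε[H] ≫ (ρ_ Hd).hom
  mul := (λ_ (Hd ⊗ Hd)).inv ≫
    (ExactPairing.coevaluation Hd H ≫ Hd ◁ (Δ[H] ≫ (β_ H H).hom)) ▷ (Hd ⊗ Hd) ⊗≫
    Hd ◁ H ◁ ExactPairing.evaluation Hd H ▷ Hd ⊗≫
    Hd ◁ ExactPairing.evaluation Hd H ≫ (ρ_ Hd).hom
  counit := (λ_ Hd).inv ≫ η[H] ▷ Hd ≫ ExactPairing.evaluation Hd H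
  comul := (λ_ Hd).inv ≫ ExactPairing.coevaluation Hd H ▷ Hd ⊗≫
    Hd ◁ ExactPairing.coevaluation Hd H ▷ H ▷ Hd ⊗≫
    (Hd ⊗ Hd) ◁ (μ[H] ▷ Hd ≫ ExactPairing.evaluation Hd H) ≫ (ρ_ (Hd ⊗ Hd)).hom
  antipode := (λ_ Hd).inv ≫ ExactPairing.coevaluation Hd H ▷ Hd ⊗≫
    Hd ◁ inv 𝒮[H] ▷ Hd ≫ Hd ◁ ExactPairing.evaluation Hd H ≫ (ρ_ Hd).hom

/-- `R = μ ∘ c ∘ (μ ⊗ λ⁻¹) ∘ (H ⊗ δ)`; on elements, `R (x ⊗ h) = λ⁻¹(h₂) x h₁`. -/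
noncomputable def doubleR : H ⊗ H ⟶ H :=
  H ◁ Δ[H] ≫ (α_ H H H).inv ≫ (μ[H] ⊗ₘ inv 𝒮[H]) ≫ (β_ H H).hom ≫ μ[H]

/-- `R̄ = (H ⊗ (μ ∘ (λ⁻¹ ⊗ H))) ∘ (δ ⊗ H) ∘ c ∘ δ`; on elements, `R̄ h = h₂ ⊗ λ⁻¹(h₃) h₁`. -/
noncomputable def doubleRbar : H ⟶ H ⊗ H :=
  Δ[H] ≫ (β_ H H).hom ≫ Δ[H] ▷ H ≫ (α_ H H H).hom ≫ H ◁ (inv 𝒮[H] ▷ H ≫ μ[H])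

/-- The left action `(H* ⊗ b) ∘ (H* ⊗ R ⊗ H*) ∘ (a ⊗ H ⊗ H*)` of `H` on `(H^cop)*`. -/
noncomputable def doubleLeftAction : H ⊗ Hd ⟶ Hd :=
  (λ_ (H ⊗ Hd)).inv ≫ ExactPairing.coevaluation Hd H ▷ (H ⊗ Hd) ⊗≫
    Hd ◁ doubleR H ▷ Hd ≫ Hd ◁ ExactPairing.evaluation Hd H ≫ (ρ_ Hd).hom

/-- The right action `(H ⊗ b) ∘ (R̄ ⊗ H*)` of `(H^cop)*` on `H`. -/
noncomputable def doubleRightAction : H ⊗ Hd ⟶ H :=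
  doubleRbar H ▷ Hd ≫ (α_ H H Hd).hom ≫ H ◁ ExactPairing.evaluation Hd H ≫ (ρ_ H).hom

/-- `T(H) = (H^cop)* ⊗ H`, the tensor product Hopf algebra. -/
noncomputable def tensorDouble : HopfData (Hd ⊗ H) :=
  (dualCop H Hd).tensor (HopfData.ofHopfObj ‹HopfObj H›)

/-- The Drinfeld double `D(H) = (H^cop)* ⋈ H`. -/
noncomputable def drinfeldDouble : HopfData (Hd ⊗ H) :=
  (dualCop H Hd).bicrossed (HopfData.ofHopfObj ‹HopfObj H›)
    (doubleLeftAction H Hd) (doubleRightAction H Hd)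

end Double

end

end HopfBraces

/-! Because H is commutative, its antipode is an involution, so R(x ⊗ h) = λ(h₂) x h₁ collapses to x
ε(h) (`doubleR_eq_fst`) and the left action φ is trivial (`doubleLeftAction_eq_snd`). Dually, A = H*
is cocommutative (`isCommComonObj_dual`). Hence D(H) is a smash product of A and B = H, with (f ⊗
h)(g ⊗ k) = f g₁ ⊗ ψ(h ⊗ g₂) k for the right action ψ = `doubleRightAction`, and T(H) is the smash
product for the trivial action.

The brace is then a general fact (`IsSmash.isHopfBrace`) about a cocommutative A acting on a
commutative B compatibly with product and coproduct. Cancelling λ(f₁) f₂ gives Γ((f ⊗ h) ⊗ (p ⊗ q))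
= ε(f) p₁ ⊗ ψ(λ(h₁) ⊗ p₂) h₂ q, and both sides of the compatibility become f g p₁ ⊗ h ψ(k ⊗ p₂) q.

The hypotheses on ψ (`isModuleBimon_doubleRightAction`) follow from ψ(h ⊗ f) = ⟨h₁, f₁⟩ h₂ ⟨h₃,
λ(f₂)⟩: in the convolution monoid, h is conjugated by the scalar ⟨h, f⟩.

Computations use generalised elements, that is, morphisms out of a comonoid Z; repeating an element
stands for applying its coproduct. H need not be cocommutative, so `Swap u v` records which elements
may be exchanged, and `ext_tensor` reduces equalities of morphisms to exchangeable comonoid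
morphisms. -/

namespace HopfBraces

/-! ### Generalised elements over a comonoid and the convolution monoid. -/

section Pairing

variable {C : Type u} [Category.{v} C] [MonoidalCategory C]
variable {Z Z' X Y W X' Y' : C} [ComonObj Z] [ComonObj Z']

/-- The morphism `(u ⊗ v) ∘ δ`, read as the pair of the generalised elements `u` and `v`. -/
def pair (u : Z ⟶ X) (v : Z ⟶ Y) : Z ⟶ X ⊗ Y := Δ[Z] ≫ (u ⊗ₘ v)

@[simp]
lemma pair_tensorHom (u : Z ⟶ X) (v : Z ⟶ Y) (s : X ⟶ X') (t : Y ⟶ Y') :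
    pair u v ≫ (s ⊗ₘ t) = pair (u ≫ s) (v ≫ t) := by
  simp [pair]

@[simp]
lemma pair_tensorHom_assoc (u : Z ⟶ X) (v : Z ⟶ Y) (s : X ⟶ X') (t : Y ⟶ Y')
    (w : X' ⊗ Y' ⟶ W) : pair u v ≫ (s ⊗ₘ t) ≫ w = pair (u ≫ s) (v ≫ t) ≫ w := by
  rw [← Category.assoc, pair_tensorHom]

@[simp]
lemma pair_whiskerRight (u : Z ⟶ X) (v : Z ⟶ Y) (s : X ⟶ X') :
    pair u v ≫ s ▷ Y = pair (u ≫ s) v := by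
  simp [pair, ← tensorHom_id]

@[simp]
lemma pair_whiskerRight_assoc (u : Z ⟶ X) (v : Z ⟶ Y) (s : X ⟶ X') (w : X' ⊗ Y ⟶ W) :
    pair u v ≫ s ▷ Y ≫ w = pair (u ≫ s) v ≫ w := by
  rw [← Category.assoc, pair_whiskerRight]

@[simp]
lemma pair_whiskerLeft (u : Z ⟶ X) (v : Z ⟶ Y) (t : Y ⟶ Y') :
    pair u v ≫ X ◁ t = pair u (v ≫ t) := by
  simp [pair, ← id_tensorHom]

@[simp]
lemma pair_whiskerLeft_assoc (u : Z ⟶ X) (v : Z ⟶ Y) (t : Y ⟶ Y') (w : X ⊗ Y' ⟶ W) :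
    pair u v ≫ X ◁ t ≫ w = pair u (v ≫ t) ≫ w := by
  rw [← Category.assoc, pair_whiskerLeft]

@[simp]
lemma pair_associator_hom (u : Z ⟶ X) (v : Z ⟶ Y) (w : Z ⟶ W) :
    pair (pair u v) w ≫ (α_ X Y W).hom = pair u (pair v w) := by
  have h : pair (pair u v) w = (Δ[Z] ≫ Δ[Z] ▷ Z) ≫ ((u ⊗ₘ v) ⊗ₘ w) := by
    rw [pair, pair, Category.assoc, ← tensorHom_id, tensorHom_comp_tensorHom, Category.id_comp]
  have h' : pair u (pair v w) = (Δ[Z] ≫ Z ◁ Δ[Z]) ≫ (u ⊗ₘ (v ⊗ₘ w)) := by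
    rw [pair, pair, Category.assoc, ← id_tensorHom, tensorHom_comp_tensorHom, Category.id_comp]
  rw [h, h', Category.assoc, associator_naturality, ComonObj.comul_assoc]
  simp

@[simp]
lemma pair_associator_hom_assoc (u : Z ⟶ X) (v : Z ⟶ Y) (w : Z ⟶ W) (t : X ⊗ Y ⊗ W ⟶ X') :
    pair (pair u v) w ≫ (α_ X Y W).hom ≫ t = pair u (pair v w) ≫ t := by
  rw [← Category.assoc, pair_associator_hom]

@[simp]
lemma pair_associator_inv (u : Z ⟶ X) (v : Z ⟶ Y) (w : Z ⟶ W) :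
    pair u (pair v w) ≫ (α_ X Y W).inv = pair (pair u v) w := by
  rw [Iso.comp_inv_eq, pair_associator_hom]

@[simp]
lemma pair_associator_inv_assoc (u : Z ⟶ X) (v : Z ⟶ Y) (w : Z ⟶ W) (t : (X ⊗ Y) ⊗ W ⟶ X') :
    pair u (pair v w) ≫ (α_ X Y W).inv ≫ t = pair (pair u v) w ≫ t := by
  rw [← Category.assoc, pair_associator_inv]

@[simp]
lemma pair_counit_leftUnitor (v : Z ⟶ Y) : pair ε[Z] v ≫ (λ_ Y).hom = v := by
  simp [pair]

@[simp]
lemma pair_counit_rightUnitor (u : Z ⟶ X) : pair u ε[Z] ≫ (ρ_ X).hom = u := by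
  simp [pair]

@[simp]
lemma pair_counit_rightUnitor_assoc (u : Z ⟶ X) (t : X ⟶ W) :
    pair u ε[Z] ≫ (ρ_ X).hom ≫ t = u ≫ t := by
  rw [← Category.assoc, pair_counit_rightUnitor]

lemma comp_leftUnitor_inv (v : Z ⟶ Y) : v ≫ (λ_ Y).inv = pair ε[Z] v := by
  simp [pair]

lemma comp_rightUnitor_inv (u : Z ⟶ X) : u ≫ (ρ_ X).inv = pair u ε[Z] := by
  simp [pair]

lemma leftUnitor_inv_eq_pair : (λ_ Z).inv = pair ε[Z] (𝟙 Z) := by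
  simp [pair]

lemma rightUnitor_inv_eq_pair : (ρ_ Z).inv = pair (𝟙 Z) ε[Z] := by
  simp [pair]

lemma comp_pair (s : Z' ⟶ Z) [IsComonHom s] (u : Z ⟶ X) (v : Z ⟶ Y) :
    s ≫ pair u v = pair (s ≫ u) (s ≫ v) := by
  simp [pair]

lemma comp_pair_assoc (s : Z' ⟶ Z) [IsComonHom s] (u : Z ⟶ X) (v : Z ⟶ Y) (t : X ⊗ Y ⟶ W) :
    s ≫ pair u v ≫ t = pair (s ≫ u) (s ≫ v) ≫ t := by
  rw [← Category.assoc, comp_pair]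

lemma comp_comul (s : Z' ⟶ Z) [IsComonHom s] : s ≫ Δ[Z] = pair s s := by
  simp [pair]

lemma isComonHom_of_pair (s : Z' ⟶ Z) (h : s ≫ ε[Z] = ε[Z']) (h' : s ≫ Δ[Z] = pair s s) :
    IsComonHom s :=
  ⟨h, h'⟩

/-- The convolution monoid of a comonoid and a monoid. -/
instance homMonoid {M : C} [MonObj M] : Monoid (Z ⟶ M) where
  one := ε[Z] ≫ η[M]
  mul u v := pair u v ≫ μ[M]
  one_mul u := by
    change pair (ε[Z] ≫ η[M]) u ≫ μ[M] = u
    rw [← pair_whiskerRight, Category.assoc, MonObj.one_mul, pair_counit_leftUnitor]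
  mul_one u := by
    change pair u (ε[Z] ≫ η[M]) ≫ μ[M] = u
    rw [← pair_whiskerLeft, Category.assoc, MonObj.mul_one, pair_counit_rightUnitor]
  mul_assoc u v w := by
    change pair (pair u v ≫ μ[M]) w ≫ μ[M] = pair u (pair v w ≫ μ[M]) ≫ μ[M]
    rw [← pair_whiskerRight, ← pair_whiskerLeft, Category.assoc, MonObj.mul_assoc,
      pair_associator_hom_assoc, Category.assoc]

variable {M N : C} [MonObj M] [MonObj N]

lemma hom_one_def : (1 : Z ⟶ M) = ε[Z] ≫ η[M] := rfl

lemma hom_mul_def (u v : Z ⟶ M) : u * v = pair u v ≫ μ[M] := rfl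

lemma comp_mul (s : Z' ⟶ Z) [IsComonHom s] (u v : Z ⟶ M) :
    s ≫ (u * v) = (s ≫ u) * (s ≫ v) := by
  simp [hom_mul_def, comp_pair_assoc]

lemma mul_comp (u v : Z ⟶ M) (s : M ⟶ N) [IsMonHom s] : (u * v) ≫ s = (u ≫ s) * (v ≫ s) := by
  simp [hom_mul_def]

lemma one_comp (s : M ⟶ N) [IsMonHom s] : (1 : Z ⟶ M) ≫ s = 1 := by
  simp [hom_one_def]

/-- The projection `X ⊗ ε`. -/
def fst (X Y : C) [ComonObj Y] : X ⊗ Y ⟶ X := X ◁ ε[Y] ≫ (ρ_ X).hom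

/-- The projection `ε ⊗ Y`. -/
def snd (X Y : C) [ComonObj X] : X ⊗ Y ⟶ Y := ε[X] ▷ Y ≫ (λ_ Y).hom

@[simp]
lemma pair_fst (u : Z ⟶ X) (v : Z ⟶ Y) [ComonObj Y] [IsComonHom v] : pair u v ≫ fst X Y = u := by
  simp [fst]

@[simp]
lemma pair_fst_assoc (u : Z ⟶ X) (v : Z ⟶ Y) [ComonObj Y] [IsComonHom v] (t : X ⟶ W) :
    pair u v ≫ fst X Y ≫ t = u ≫ t := by
  rw [← Category.assoc, pair_fst]

@[simp]
lemma pair_snd (u : Z ⟶ X) (v : Z ⟶ Y) [ComonObj X] [IsComonHom u] : pair u v ≫ snd X Y = v := by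
  simp [snd]

@[simp]
lemma pair_snd_assoc (u : Z ⟶ X) (v : Z ⟶ Y) [ComonObj X] [IsComonHom u] (t : Y ⟶ W) :
    pair u v ≫ snd X Y ≫ t = v ≫ t := by
  rw [← Category.assoc, pair_snd]

end Pairing

/-! ### Exchangeable generalised elements; instance search discharges the cocommutativity
conditions. -/

section Swap

variable {C : Type u} [Category.{v} C] [MonoidalCategory C] [SymmetricCategory C]
variable {Z Z' X Y W X' Y' : C} [ComonObj Z] [ComonObj Z']

/-- The generalised elements `u` and `v` may be evaluated in either order. -/
class Swap (u : Z ⟶ X) (v : Z ⟶ Y) : Prop where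
  swap (u v) : pair u v ≫ (β_ X Y).hom = pair v u

attribute [simp] Swap.swap

@[simp]
lemma Swap.swap_assoc (u : Z ⟶ X) (v : Z ⟶ Y) [Swap u v] (t : Y ⊗ X ⟶ W) :
    pair u v ≫ (β_ X Y).hom ≫ t = pair v u ≫ t := by
  rw [← Category.assoc, Swap.swap]

lemma Swap.symm (u : Z ⟶ X) (v : Z ⟶ Y) [Swap u v] : Swap v u :=
  ⟨by rw [← Swap.swap u v, Category.assoc, SymmetricCategory.symmetry, Category.comp_id]⟩

attribute [instance 10] Swap.symm

instance (u : Z ⟶ X) (v : Z ⟶ Y) (s : X ⟶ X') [Swap u v] : Swap (u ≫ s) v :=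
  ⟨by rw [← pair_whiskerRight, Category.assoc, BraidedCategory.braiding_naturality_left,
    Swap.swap_assoc, pair_whiskerLeft]⟩

instance (u : Z ⟶ X) (v : Z ⟶ Y) (w : Z ⟶ W) [Swap u w] [Swap v w] : Swap (pair u v) w where
  swap := by
    rw [← Category.comp_id (β_ _ _).hom, ← pair_associator_inv u v w]
    simp [BraidedCategory.braiding_tensor_left_hom]

instance swap_self [ComonObj X] [IsCommComonObj X] (u : Z ⟶ X) [IsComonHom u] : Swap u u where
  swap := by rw [← comp_comul, Category.assoc, IsCommComonObj.comul_comm]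

instance swap_counit (u : Z ⟶ X) : Swap u ε[Z] where
  swap := by
    rw [← comp_rightUnitor_inv, ← comp_leftUnitor_inv]; simp

instance {M : C} [MonObj M] (u v : Z ⟶ M) (w : Z ⟶ X) [Swap u w] [Swap v w] :
    Swap (u * v) w :=
  inferInstanceAs (Swap (pair u v ≫ μ[M]) w)

instance {M : C} [MonObj M] (w : Z ⟶ X) : Swap w (1 : Z ⟶ M) :=
  inferInstanceAs (Swap w (ε[Z] ≫ η[M]))

instance Swap.precomp (s : Z' ⟶ Z) [IsComonHom s] (u : Z ⟶ X) (v : Z ⟶ Y) [Swap u v] :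
    Swap (s ≫ u) (s ≫ v) :=
  ⟨by simp [← comp_pair]⟩

lemma hom_mul_comm {M : C} [MonObj M] [IsCommMonObj M] (u v : Z ⟶ M) [Swap u v] :
    u * v = v * u := by
  rw [hom_mul_def, hom_mul_def, ← Swap.swap u v, Category.assoc, IsCommMonObj.mul_comm]

@[simp]
lemma pair_tensorμ (a : Z ⟶ X) (b : Z ⟶ Y) (c : Z ⟶ X') (d : Z ⟶ Y') [Swap b c] :
    pair (pair a b) (pair c d) ≫ tensorμ X Y X' Y' = pair (pair a c) (pair b d) := by
  simp [tensorμ]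

@[simp]
lemma pair_tensorμ_assoc (a : Z ⟶ X) (b : Z ⟶ Y) (c : Z ⟶ X') (d : Z ⟶ Y') [Swap b c]
    (t : (X ⊗ X') ⊗ (Y ⊗ Y') ⟶ W) :
    pair (pair a b) (pair c d) ≫ tensorμ X Y X' Y' ≫ t = pair (pair a c) (pair b d) ≫ t := by
  rw [← Category.assoc, pair_tensorμ]

lemma pair_mul_pair {M N : C} [MonObj M] [MonObj N] (a c : Z ⟶ M) (b d : Z ⟶ N) [Swap b c] :
    pair a b * pair c d = pair (a * c) (b * d) := by
  simp [hom_mul_def, MonObj.tensorObj.mul_def]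

lemma pair_one_one {M N : C} [MonObj M] [MonObj N] : pair (1 : Z ⟶ M) (1 : Z ⟶ N) = 1 := by
  have : (1 : Z ⟶ M ⊗ N) = ε[Z] ≫ (λ_ _).inv ≫ (η[M] ⊗ₘ η[N]) := rfl
  rw [this, ← Category.assoc, comp_leftUnitor_inv]
  simp [hom_one_def]

/-- The coproduct of X ⊗ Y interleaves the factors, so the two middle legs u and v must be
exchanged. -/
instance isComonHom_pair [ComonObj X] [ComonObj Y] (u : Z ⟶ X) (v : Z ⟶ Y) [IsComonHom u]
    [IsComonHom v] [Swap u v] : IsComonHom (pair u v) := by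
  refine isComonHom_of_pair _ ?_ ?_
  · simp
  · simp [comp_comul, -IsComonHom.hom_comul]

variable [ComonObj X] [ComonObj Y]

lemma unitors_inv_tensorμ (X Y : C) :
    ((ρ_ X).inv ⊗ₘ (λ_ Y).inv) ≫ tensorμ X (𝟙_ C) (𝟙_ C) Y ≫ ((ρ_ X).hom ⊗ₘ (λ_ Y).hom) = 𝟙 _ := by
  simp only [tensorμ, braiding_tensorUnit_left, comp_whiskerRight, whiskerLeft_comp]
  monoidal

lemma unitors_inv_tensorμ_swap (X Y : C) :
    ((λ_ X).inv ⊗ₘ (ρ_ Y).inv) ≫ tensorμ (𝟙_ C) X Y (𝟙_ C) ≫ ((λ_ Y).hom ⊗ₘ (ρ_ X).hom) =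
      (β_ X Y).hom := by
  simp only [tensorμ]
  monoidal

@[simp]
lemma pair_fst_snd : pair (fst X Y) (snd X Y) = 𝟙 (X ⊗ Y) := by
  rw [pair, fst, snd, Comon.tensorObj_comul, Category.assoc,
    ← tensorHom_comp_tensorHom, ← id_tensorHom, ← tensorHom_id, ← tensorμ_natural_assoc,
    tensorHom_comp_tensorHom_assoc, ComonObj.comul_counit_hom, ComonObj.counit_comul_hom,
    Category.id_comp, Category.id_comp, unitors_inv_tensorμ]

lemma pair_snd_fst : pair (snd X Y) (fst X Y) = (β_ X Y).hom := by
  rw [pair, fst, snd, Comon.tensorObj_comul, Category.assoc,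
    ← tensorHom_comp_tensorHom, ← id_tensorHom, ← tensorHom_id, ← tensorμ_natural_assoc,
    tensorHom_comp_tensorHom_assoc, ComonObj.comul_counit_hom, ComonObj.counit_comul_hom,
    Category.id_comp, Category.id_comp, unitors_inv_tensorμ_swap]

instance swap_fst_snd : Swap (fst X Y) (snd X Y) :=
  ⟨by rw [pair_fst_snd, pair_snd_fst, Category.id_comp]⟩

instance : IsComonHom (fst X Y) := by
  refine isComonHom_of_pair _ (by simp [fst, MonoidalCategory.tensorHom_def', ← unitors_inv_equal]) ?_
  rw [pair, fst, Comon.tensorObj_comul, Category.assoc (Δ[X] ⊗ₘ Δ[Y]),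
    ← tensorHom_comp_tensorHom, ← id_tensorHom, ← tensorμ_natural_assoc,
    tensorHom_comp_tensorHom_assoc, ComonObj.comul_counit_hom, id_tensorHom_id, Category.comp_id,
    ← Category.comp_id Δ[X], ← tensorHom_comp_tensorHom_assoc, id_tensorHom, id_tensorHom,
    ← unitors_inv_equal, ← tensor_right_unitality]
  simp [MonoidalCategory.tensorHom_def']

instance : IsComonHom (snd X Y) := by
  refine isComonHom_of_pair _ (by simp [snd, MonoidalCategory.tensorHom_def]) ?_
  rw [pair, snd, Comon.tensorObj_comul, Category.assoc (Δ[X] ⊗ₘ Δ[Y]),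
    ← tensorHom_comp_tensorHom, ← tensorHom_id, ← tensorμ_natural_assoc,
    tensorHom_comp_tensorHom_assoc, ComonObj.counit_comul_hom, id_tensorHom_id, Category.comp_id,
    ← Category.comp_id Δ[Y], ← tensorHom_comp_tensorHom_assoc, tensorHom_id, tensorHom_id,
    ← tensor_left_unitality]
  simp [MonoidalCategory.tensorHom_def]

lemma eq_pair_comp_fst_snd (w : Z ⟶ X ⊗ Y) [IsComonHom w] :
    w = pair (w ≫ fst X Y) (w ≫ snd X Y) := by
  rw [← comp_pair, pair_fst_snd, Category.comp_id]

instance {M : C} [BimonObj M] (u v : Z ⟶ M) [IsComonHom u] [IsComonHom v] [Swap u v] :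
    IsComonHom (u * v) := by
  refine isComonHom_of_pair _ ?_ ?_
  · simp [hom_mul_def]
  · simp [hom_mul_def, comp_comul, -IsComonHom.hom_comul]

instance {M : C} [BimonObj M] : IsComonHom (1 : Z ⟶ M) := by
  refine isComonHom_of_pair _ ?_ ?_
  · simp [hom_one_def]
  · rw [pair_one_one]; simp [hom_one_def]

end Swap

section Antipode

variable {C : Type u} [Category.{v} C] [MonoidalCategory C] [SymmetricCategory C]
variable {Z M : C} [ComonObj Z] [HopfObj M]

lemma comp_antipode_mul_self (u : Z ⟶ M) [IsComonHom u] : (u ≫ 𝒮[M]) * u = 1 := by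
  rw [hom_mul_def, ← pair_whiskerRight, ← comp_comul, Category.assoc, Category.assoc,
    HopfObj.antipode_left, IsComonHom.hom_counit_assoc, hom_one_def]

lemma self_mul_comp_antipode (u : Z ⟶ M) [IsComonHom u] : u * (u ≫ 𝒮[M]) = 1 := by
  rw [hom_mul_def, ← pair_whiskerLeft, ← comp_comul, Category.assoc, Category.assoc,
    HopfObj.antipode_right, IsComonHom.hom_counit_assoc, hom_one_def]

instance isComonHom_antipode [IsCommComonObj M] : IsComonHom 𝒮[M] where
  hom_comul := by rw [HopfObj.antipode_comul, IsCommComonObj.comul_comm_assoc]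

end Antipode

/-! ### Smash products and the Hopf brace they form with the tensor product. -/

section Smash

variable {C : Type u} [Category.{v} C] [MonoidalCategory C] [SymmetricCategory C]
variable {A B : C} [HopfObj A] [HopfObj B]

/-- `ψ` is a right action of the bimonoid `A` on `B` by comonoid morphisms, compatible with the
product and the unit of `B`. -/
structure IsModuleBimon (ψ : B ⊗ A ⟶ B) : Prop where
  isComonHom : IsComonHom ψ
  act_mul {Z : C} [ComonObj Z] (u : Z ⟶ B) (f g : Z ⟶ A) [IsComonHom f] [IsComonHom g] [Swap f g] :
    pair u (f * g) ≫ ψ = pair (pair u f ≫ ψ) g ≫ ψ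
  act_one {Z : C} [ComonObj Z] (u : Z ⟶ B) : pair u (1 : Z ⟶ A) ≫ ψ = u
  mul_act {Z : C} [ComonObj Z] (u v : Z ⟶ B) (f : Z ⟶ A) [IsComonHom f] [Swap v f] :
    pair (u * v) f ≫ ψ = (pair u f ≫ ψ) * (pair v f ≫ ψ)
  one_act {Z : C} [ComonObj Z] (f : Z ⟶ A) [IsComonHom f] : pair (1 : Z ⟶ B) f ≫ ψ = 1

/-- `m` is the product of the smash product for the right action `ψ`; on generalised elements,
`(f ⊗ h) (g ⊗ k) = f g ⊗ ψ (h ⊗ g) k`. -/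
def IsSmashMul (ψ : B ⊗ A ⟶ B) (m : (A ⊗ B) ⊗ (A ⊗ B) ⟶ A ⊗ B) : Prop :=
  ∀ {Z : C} [ComonObj Z] (f : Z ⟶ A) (h : Z ⟶ B) (g : Z ⟶ A) (k : Z ⟶ B) [IsComonHom g]
    [Swap h g], pair (pair f h) (pair g k) ≫ m = pair (f * g) ((pair h g ≫ ψ) * k)

/-- The two projections of X ⊗ Y are exchangeable comonoid morphisms whose pair is the identity, so
they are the universal test elements. -/
lemma ext_tensor {X Y W : C} [ComonObj X] [ComonObj Y] {m m' : X ⊗ Y ⟶ W}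
    (h : ∀ {Z : C} [ComonObj Z] (x : Z ⟶ X) (y : Z ⟶ Y) [IsComonHom x] [IsComonHom y] [Swap x y],
      pair x y ≫ m = pair x y ≫ m') : m = m' := by
  simpa using h (fst X Y) (snd X Y)

variable {ψ : B ⊗ A ⟶ B} {m : (A ⊗ B) ⊗ (A ⊗ B) ⟶ A ⊗ B}

lemma IsSmashMul.assoc [IsCommComonObj A] (hψ : IsModuleBimon ψ) (hm : IsSmashMul ψ m)
    {Z : C} [ComonObj Z] (f g p : Z ⟶ A) (h k q : Z ⟶ B) [IsComonHom g] [IsComonHom p]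
    [Swap g p] [Swap h g] [Swap h p] [Swap k p] :
    pair (pair (pair f h) (pair g k) ≫ m) (pair p q) ≫ m =
      pair (pair f h) (pair (pair g k) (pair p q) ≫ m) ≫ m := by
  rw [hm f h g k, hm g k p q, hm, hm, hψ.mul_act, hψ.act_mul, mul_assoc, mul_assoc]

-- In f g ⊗ ψ(h ⊗ g) k the element g occurs in both legs. Cocommutativity of A makes g exchangeable
-- with itself, and the formula is then built only from operations that preserve comonoid morphisms.
set_option synthInstance.maxSize 2000 in
set_option synthInstance.maxHeartbeats 200000 in
lemma IsSmashMul.isComonHom [IsCommComonObj A] (hψ : IsModuleBimon ψ) (hm : IsSmashMul ψ m) :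
    IsComonHom m := by
  have := hψ.isComonHom
  have h : m = pair ((fst _ _ ≫ fst A B) * (snd _ _ ≫ fst A B))
      ((pair (fst _ _ ≫ snd A B) (snd _ _ ≫ fst A B) ≫ ψ) * (snd _ _ ≫ snd A B)) := by
    rw [← hm, ← eq_pair_comp_fst_snd, ← eq_pair_comp_fst_snd, pair_fst_snd, Category.id_comp]
  rw [h]
  infer_instance

/-- The structure morphisms `D` are those of the smash product for the right action `ψ`. -/
structure IsSmash (ψ : B ⊗ A ⟶ B) (D : HopfData (A ⊗ B)) : Prop where
  one : D.one = (λ_ (𝟙_ C)).inv ≫ (η[A] ⊗ₘ η[B])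
  mul : IsSmashMul ψ D.mul
  counit : D.counit = ε[A ⊗ B]
  comul : D.comul = Δ[A ⊗ B]
  antipode : D.antipode =
    pair (fst A B ≫ 𝒮[A]) (pair (snd A B ≫ 𝒮[B]) (fst A B ≫ 𝒮[A]) ≫ ψ)

variable {D : HopfData (A ⊗ B)}

lemma IsSmash.counit_one (hD : IsSmash ψ D) {Z : C} [ComonObj Z] :
    ε[Z] ≫ D.one = pair (1 : Z ⟶ A) (1 : Z ⟶ B) := by
  rw [hD.one, ← Category.assoc, comp_leftUnitor_inv, pair_tensorHom]
  rfl

lemma IsSmash.pair_antipode (hD : IsSmash ψ D) {Z : C} [ComonObj Z] (f : Z ⟶ A) (h : Z ⟶ B)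
    [IsComonHom f] [IsComonHom h] [Swap f h] :
    pair f h ≫ D.antipode = pair (f ≫ 𝒮[A]) (pair (h ≫ 𝒮[B]) (f ≫ 𝒮[A]) ≫ ψ) := by
  simp [hD.antipode, comp_pair, comp_pair_assoc]

-- The unit is a pair of generalised elements over the trivial comonoid, so the rule for pairs
-- applies.
attribute [local instance] ComonObj.instTensorUnit in
lemma IsSmash.isComonHom_one (hD : IsSmash ψ D) :
    D.one ≫ Δ[A ⊗ B] = (λ_ (𝟙_ C)).inv ≫ (D.one ⊗ₘ D.one) ∧ D.one ≫ ε[A ⊗ B] = 𝟙 (𝟙_ C) := by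
  have hA : IsComonHom η[A] := ⟨by simp, by simp [MonObj.tensorObj.one_def]⟩
  have hB : IsComonHom η[B] := ⟨by simp, by simp [MonObj.tensorObj.one_def]⟩
  have hs : Swap η[A] η[B] := ⟨by simp [pair, unitors_inv_equal]⟩
  have h : D.one = pair η[A] η[B] := hD.one
  rw [h]
  exact ⟨IsComonHom.hom_comul _, IsComonHom.hom_counit _⟩

lemma IsSmash.isHopf [IsCommComonObj A] (hψ : IsModuleBimon ψ) (hD : IsSmash ψ D) : D.IsHopf := by
  have := hψ.isComonHom
  have hmul := IsSmashMul.isComonHom hψ hD.mul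
  let mon : MonObj (A ⊗ B) :=
    { one := D.one
      mul := D.mul
      one_mul := by
        rw [← cancel_epi (λ_ _).inv, Iso.inv_hom_id, leftUnitor_inv_eq_pair, pair_whiskerRight_assoc,
          hD.counit_one, ← pair_fst_snd, hD.mul, hψ.one_act, one_mul, one_mul]
      mul_one := by
        rw [← cancel_epi (ρ_ _).inv, Iso.inv_hom_id, rightUnitor_inv_eq_pair,
          pair_whiskerLeft_assoc,
          hD.counit_one, ← pair_fst_snd, hD.mul, hψ.act_one, mul_one, mul_one]
      mul_assoc := by
        refine ext_tensor fun w z _ _ _ => ?_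
        rw [eq_pair_comp_fst_snd w, eq_pair_comp_fst_snd (w ≫ fst _ _),
          eq_pair_comp_fst_snd (w ≫ snd _ _), eq_pair_comp_fst_snd z]
        rw [pair_whiskerRight_assoc, IsSmashMul.assoc hψ hD.mul, pair_associator_hom_assoc,
          pair_whiskerLeft_assoc] }
  let bimon : BimonObj (A ⊗ B) :=
    { mon, (inferInstance : ComonObj (A ⊗ B)) with
      mul_comul := by
        rw [← Category.assoc, ← Comon.tensorObj_comul]
        exact IsComonHom.hom_comul (f := D.mul)
      one_comul := hD.isComonHom_one.1
      mul_counit := IsComonHom.hom_counit (f := D.mul)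
      one_counit := hD.isComonHom_one.2 }
  let hopf : HopfObj (A ⊗ B) :=
    { bimon with
      antipode := D.antipode
      antipode_left := by
        change Δ[A ⊗ B] ≫ D.antipode ▷ (A ⊗ B) ≫ D.mul = ε[A ⊗ B] ≫ D.one
        have h : Δ[A ⊗ B] = pair (𝟙 _) (𝟙 _) := by simp [pair]
        -- ψ(ψ(λh ⊗ λf) ⊗ f) h = ψ(λh ⊗ (λf) f) h = (λh) h = 1.
        rw [h, pair_whiskerRight_assoc, Category.id_comp, ← pair_fst_snd, hD.antipode, hD.mul,
          ← hψ.act_mul, comp_antipode_mul_self, hψ.act_one, comp_antipode_mul_self, hD.counit_one]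
      antipode_right := by
        change Δ[A ⊗ B] ≫ (A ⊗ B) ◁ D.antipode ≫ D.mul = ε[A ⊗ B] ≫ D.one
        have h : Δ[A ⊗ B] = pair (𝟙 _) (𝟙 _) := by simp [pair]
        -- ψ(h ⊗ λf) ψ(λh ⊗ λf) = ψ(h (λh) ⊗ λf) = ψ(1 ⊗ λf) = 1.
        rw [h, pair_whiskerLeft_assoc, Category.id_comp, ← pair_fst_snd, hD.antipode, hD.mul,
          ← hψ.mul_act, self_mul_comp_antipode, self_mul_comp_antipode, hψ.one_act, hD.counit_one] }
  refine ⟨hopf, HopfData.ext rfl rfl hD.counit.symm hD.comul.symm rfl⟩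

lemma pair_braceGamma (D₁ D₂ : HopfData (A ⊗ B)) (h : D₁.comul = Δ[A ⊗ B]) {Z : C} [ComonObj Z]
    (x y : Z ⟶ A ⊗ B) [IsComonHom x] :
    pair x y ≫ braceGamma D₁ D₂ = pair (x ≫ D₁.antipode) (pair x y ≫ D₂.mul) ≫ D₁.mul := by
  rw [braceGamma, h, pair_whiskerRight_assoc, comp_comul, pair_associator_hom_assoc,
    pair_tensorHom_assoc]

variable {ψ₀ : B ⊗ A ⟶ B} {D₀ : HopfData (A ⊗ B)}

lemma IsSmash.compat_apply [IsCommComonObj A] [IsCommMonObj B] (hψ : IsModuleBimon ψ)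
    (hD : IsSmash ψ D) (hD₀ : IsSmash ψ₀ D₀)
    (htriv : ∀ {Z : C} [ComonObj Z] (u : Z ⟶ B) (f : Z ⟶ A) [IsComonHom f],
      pair u f ≫ ψ₀ = u) {Z : C} [ComonObj Z] (f g p : Z ⟶ A) (h k q : Z ⟶ B)
    [IsComonHom f] [IsComonHom g] [IsComonHom p] [IsComonHom h] [Swap f h] [Swap f g] [Swap f p]
    [Swap g p] [Swap h g] [Swap h p] [Swap h k] [Swap k p] :
    pair (pair f h) (pair (pair g k) (pair p q) ≫ D.mul) ≫ D₀.mul =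
      pair (pair (pair f h) (pair g k) ≫ D₀.mul)
        (pair (pair f h ≫ D.antipode) (pair (pair f h) (pair p q) ≫ D₀.mul) ≫ D.mul) ≫ D.mul := by
  have hf : (f ≫ 𝒮[A]) * (f * p) = p := by
    rw [← mul_assoc, comp_antipode_mul_self, one_mul]
  -- This collapses ψ(hk ⊗ p) ψ(λh ⊗ p) = ψ(h k λ(h) ⊗ p) to ψ(k ⊗ p). The leftover h moves past ψ(k
  -- ⊗ p) because B is commutative.
  have hk : (h * k) * (h ≫ 𝒮[B]) = k := by
    rw [hom_mul_comm h k, mul_assoc, self_mul_comp_antipode, mul_one]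
  rw [hD.mul g k p q, hD₀.mul f h (g * p), htriv, hD₀.mul f h g k, htriv, hD.pair_antipode,
    hD₀.mul f h p q, htriv, hD.mul, ← hψ.act_mul, hf, hD.mul, ← mul_assoc (pair (h * k) p ≫ ψ),
    ← hψ.mul_act, hk, mul_assoc, ← mul_assoc h, hom_mul_comm h (pair k p ≫ ψ), mul_assoc]

/-- The smash product for a right action and the one for the trivial action form a Hopf brace. -/
theorem IsSmash.isHopfBrace [IsCommComonObj A] [IsCommMonObj B] (hψ : IsModuleBimon ψ)
    (hψ₀ : IsModuleBimon ψ₀) (hD : IsSmash ψ D) (hD₀ : IsSmash ψ₀ D₀)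
    (htriv : ∀ {Z : C} [ComonObj Z] (u : Z ⟶ B) (f : Z ⟶ A) [IsComonHom f],
      pair u f ≫ ψ₀ = u) : IsHopfBrace D D₀ where
  isHopf_fst := hD.isHopf hψ
  isHopf_snd := hD₀.isHopf hψ₀
  counit_eq := hD.counit.trans hD₀.counit.symm
  comul_eq := hD.comul.trans hD₀.comul.symm
  compat := by
    refine ext_tensor fun x w _ _ _ => ?_
    rw [eq_pair_comp_fst_snd w, pair_whiskerLeft_assoc, hD.comul, pair_whiskerRight_assoc,
      comp_comul, pair_tensorμ_assoc, pair_tensorHom_assoc, pair_braceGamma _ _ hD.comul]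
    rw [eq_pair_comp_fst_snd x, eq_pair_comp_fst_snd (w ≫ fst _ _),
      eq_pair_comp_fst_snd (w ≫ snd _ _)]
    exact hD.compat_apply hψ hD₀ htriv ..

end Smash

/-! ### Tensor products, and bicrossed products with trivial left action, as smash products. -/

section Bicrossed

variable {C : Type u} [Category.{v} C] [MonoidalCategory C] [SymmetricCategory C]
variable (A B : C) [hA : HopfObj A] [hB : HopfObj B]

lemma isModuleBimon_fst : IsModuleBimon (fst B A) where
  isComonHom := inferInstance
  act_mul u f g _ _ _ := by simp
  act_one u := by simp
  mul_act u v f _ _ := by simp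
  one_act f _ := by simp

lemma isSmash_tensor [IsCommComonObj A] :
    IsSmash (fst B A) ((HopfData.ofHopfObj hA).tensor (HopfData.ofHopfObj hB)) where
  one := rfl
  mul f h g k _ _ := by
    simp [HopfData.tensor, HopfData.ofHopfObj, hom_mul_def]
  counit := rfl
  comul := by simp [HopfData.tensor, HopfData.ofHopfObj]
  antipode := by
    have h := (pair_fst_snd (X := A) (Y := B)).symm =≫ (𝒮[A] ⊗ₘ 𝒮[B])
    rw [Category.id_comp, pair_tensorHom] at h
    rw [pair_fst]
    exact h

variable {A B}

/-- The counit removes one leg of the coproduct of B. The resulting form f₁ ⊗ ψ(h ⊗ f₂) does not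
duplicate h, so it can be evaluated at an h that is not a comonoid morphism. -/
lemma bicrossedPsi_snd (ψ : B ⊗ A ⟶ B) :
    bicrossedPsi (HopfData.ofHopfObj hA) (HopfData.ofHopfObj hB) (snd B A) ψ =
      B ◁ Δ[A] ≫ (α_ B A A).inv ≫ (β_ B A).hom ▷ A ≫ (α_ A B A).hom ≫ A ◁ ψ := by
  refine ext_tensor fun x y _ _ _ => ?_
  have h : bicrossedPsi (HopfData.ofHopfObj hA) (HopfData.ofHopfObj hB) (snd B A) ψ =
      pair (snd B A) ψ := by
    simp [bicrossedPsi, HopfData.ofHopfObj, pair]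
  rw [h, comp_pair, pair_snd, pair_whiskerLeft_assoc, comp_comul]
  simp

lemma pair_bicrossedPsi_snd (ψ : B ⊗ A ⟶ B) {Z : C} [ComonObj Z] (u : Z ⟶ B) (f : Z ⟶ A)
    [IsComonHom f] [Swap u f] :
    pair u f ≫ bicrossedPsi (HopfData.ofHopfObj hA) (HopfData.ofHopfObj hB) (snd B A) ψ =
      pair f (pair u f ≫ ψ) := by
  rw [bicrossedPsi_snd, pair_whiskerLeft_assoc, comp_comul]
  simp

lemma isSmash_bicrossed [IsCommComonObj A] (ψ : B ⊗ A ⟶ B) :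
    IsSmash ψ ((HopfData.ofHopfObj hA).bicrossed (HopfData.ofHopfObj hB) (snd B A) ψ) where
  one := rfl
  mul f h g k _ _ := by
    have e (Ψ : B ⊗ A ⟶ A ⊗ B) (m : (A ⊗ A) ⊗ B ⊗ B ⟶ A ⊗ B) :
        (𝟙 ((A ⊗ B) ⊗ A ⊗ B) ⊗≫ A ◁ Ψ ▷ B ⊗≫ m) =
        (α_ A B (A ⊗ B)).hom ≫ A ◁ (α_ B A B).inv ≫ A ◁ (Ψ ▷ B) ≫ A ◁ (α_ A B B).hom ≫
          (α_ A A (B ⊗ B)).inv ≫ m := by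
      monoidal
    simp only [HopfData.bicrossed]
    rw [e]
    simp only [pair_associator_hom_assoc, pair_whiskerLeft_assoc, pair_associator_inv,
      pair_whiskerRight, pair_bicrossedPsi_snd, pair_associator_hom, pair_associator_inv_assoc,
      pair_tensorHom]
    rfl
  counit := rfl
  comul := by simp [HopfData.tensor, HopfData.ofHopfObj, HopfData.bicrossed]
  antipode := by
    simp only [HopfData.bicrossed]
    rw [← pair_snd_fst, pair_tensorHom_assoc]
    exact pair_bicrossedPsi_snd ψ (snd A B ≫ 𝒮[B]) (fst A B ≫ 𝒮[A])

end Bicrossed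

open ExactPairing

/-! ### Morphisms into the dual are determined by evaluation against H. -/

section Evaluation

variable {C : Type u} [Category.{v} C] [MonoidalCategory C] {H Hd : C} [ExactPairing Hd H]

/-- Evaluation of the first tensor factor. -/
def evalFst (H Hd W : C) [ExactPairing Hd H] : H ⊗ Hd ⊗ W ⟶ W :=
  (α_ H Hd W).inv ≫ evaluation Hd H ▷ W ≫ (λ_ W).hom

lemma eq_of_whiskerLeft_evalFst {Z W : C} {u v : Z ⟶ Hd ⊗ W}
    (h : H ◁ u ≫ evalFst H Hd W = H ◁ v ≫ evalFst H Hd W) : u = v :=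
  (tensorLeftHomEquiv Z Hd H W).symm.injective h

lemma whiskerLeft_rightUnitor_inv_evalFst {Z : C} (u : Z ⟶ Hd) :
    H ◁ (u ≫ (ρ_ Hd).inv) ≫ evalFst H Hd (𝟙_ C) = H ◁ u ≫ evaluation Hd H := by
  simp [evalFst, ← unitors_inv_equal]

lemma eq_of_whiskerLeft_evaluation {Z : C} {u v : Z ⟶ Hd}
    (h : H ◁ u ≫ evaluation Hd H = H ◁ v ≫ evaluation Hd H) : u = v := by
  rw [← cancel_mono (ρ_ Hd).inv]
  apply eq_of_whiskerLeft_evalFst (H := H)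
  rw [whiskerLeft_rightUnitor_inv_evalFst, whiskerLeft_rightUnitor_inv_evalFst, h]

lemma whiskerLeft_tensorLeftHomEquiv_evalFst {Z W : C} (t : H ⊗ Z ⟶ W) :
    H ◁ tensorLeftHomEquiv Z Hd H W t ≫ evalFst H Hd W = t :=
  (tensorLeftHomEquiv Z Hd H W).symm_apply_apply t

/-- The transpose of a morphism along the exact pairing. -/
def transpose {Z : C} (t : H ⊗ Z ⟶ 𝟙_ C) : Z ⟶ Hd :=
  tensorLeftHomEquiv Z Hd H (𝟙_ C) t ≫ (ρ_ Hd).hom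

lemma whiskerLeft_transpose_evaluation {Z : C} (t : H ⊗ Z ⟶ 𝟙_ C) :
    H ◁ (transpose t : Z ⟶ Hd) ≫ evaluation Hd H = t := by
  rw [← whiskerLeft_rightUnitor_inv_evalFst, transpose, Category.assoc, Iso.hom_inv_id,
    Category.comp_id, whiskerLeft_tensorLeftHomEquiv_evalFst]

end Evaluation

/-! ### Pairing formulas for the dual, and its comonoid laws. -/

section DualData

variable {C : Type u} [Category.{v} C] [MonoidalCategory C] [SymmetricCategory C]
variable (H Hd : C) [HopfObj H] [IsIso 𝒮[H]] [ExactPairing Hd H]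

lemma whiskerLeft_dualCop_one :
    H ◁ (dualCop H Hd).one ≫ evaluation Hd H = (ρ_ H).hom ≫ ε[H] := by
  have h : (dualCop H Hd).one = transpose ((ρ_ H).hom ≫ ε[H]) := by
    simp only [dualCop, transpose, tensorLeftHomEquiv, Equiv.coe_fn_mk]
    monoidal
  rw [h, whiskerLeft_transpose_evaluation]

lemma whiskerLeft_dualCop_mul :
    H ◁ (dualCop H Hd).mul ≫ evaluation Hd H =
      (Δ[H] ≫ (β_ H H).hom) ▷ (Hd ⊗ Hd) ≫ (α_ H H (Hd ⊗ Hd)).hom ≫ H ◁ (α_ H Hd Hd).inv ≫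
        H ◁ (evaluation Hd H ▷ Hd ≫ (λ_ Hd).hom) ≫ evaluation Hd H := by
  have h : (dualCop H Hd).mul = transpose ((Δ[H] ≫ (β_ H H).hom) ▷ (Hd ⊗ Hd) ≫
      (α_ H H (Hd ⊗ Hd)).hom ≫ H ◁ (α_ H Hd Hd).inv ≫
        H ◁ (evaluation Hd H ▷ Hd ≫ (λ_ Hd).hom) ≫ evaluation Hd H) := by
    simp only [dualCop, transpose, tensorLeftHomEquiv, Equiv.coe_fn_mk]
    monoidal
  rw [h, whiskerLeft_transpose_evaluation]

lemma whiskerLeft_dualCop_antipode :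
    H ◁ (dualCop H Hd).antipode ≫ evaluation Hd H = inv 𝒮[H] ▷ Hd ≫ evaluation Hd H := by
  have h : (dualCop H Hd).antipode = transpose (inv 𝒮[H] ▷ Hd ≫ evaluation Hd H) := by
    simp only [dualCop, transpose, tensorLeftHomEquiv, Equiv.coe_fn_mk]
    monoidal
  rw [h, whiskerLeft_transpose_evaluation]

lemma whiskerLeft_doubleLeftAction :
    H ◁ doubleLeftAction H Hd ≫ evaluation Hd H =
      (α_ H H Hd).inv ≫ doubleR H ▷ Hd ≫ evaluation Hd H := by
  have h : doubleLeftAction H Hd =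
      transpose ((α_ H H Hd).inv ≫ doubleR H ▷ Hd ≫ evaluation Hd H) := by
    simp only [doubleLeftAction, transpose, tensorLeftHomEquiv, Equiv.coe_fn_mk]
    monoidal
  rw [h, whiskerLeft_transpose_evaluation]

/-- The action `x ⊗ f ↦ f₂ ⟨x, f₁⟩` of `H` on its dual; on `H`, it evaluates as
`⟨y, x · f⟩ = ⟨y x, f⟩`. -/
def dualAct : H ⊗ Hd ⟶ Hd := transpose ((α_ H H Hd).inv ≫ μ[H] ▷ Hd ≫ evaluation Hd H)

omit [IsIso 𝒮[H]] in
lemma whiskerLeft_dualAct :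
    H ◁ dualAct H Hd ≫ evaluation Hd H = (α_ H H Hd).inv ≫ μ[H] ▷ Hd ≫ evaluation Hd H :=
  whiskerLeft_transpose_evaluation _

lemma whiskerLeft_dualCop_comul :
    H ◁ (dualCop H Hd).comul ≫ evalFst H Hd Hd = dualAct H Hd := by
  have h : (dualCop H Hd).comul = tensorLeftHomEquiv Hd Hd H Hd (dualAct H Hd) := by
    simp only [dualCop, dualAct, transpose, tensorLeftHomEquiv, Equiv.coe_fn_mk]
    monoidal
  rw [h, whiskerLeft_tensorLeftHomEquiv_evalFst]

lemma whiskerLeft_dualCop_comul_assoc {W : C} (t : Hd ⟶ W) :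
    H ◁ (dualCop H Hd).comul ≫ evalFst H Hd Hd ≫ t = dualAct H Hd ≫ t := by
  rw [← Category.assoc, whiskerLeft_dualCop_comul]

omit [SymmetricCategory C] [HopfObj H] [IsIso 𝒮[H]] in
lemma evalFst_naturality {W W' : C} (t : W ⟶ W') :
    evalFst H Hd W ≫ t = H ◁ Hd ◁ t ≫ evalFst H Hd W' := by
  simp only [evalFst, Category.assoc, ← leftUnitor_naturality,
    ← whisker_exchange_assoc]
  simp

/-- Evaluating one factor turns the coproduct into `dualAct`; evaluating two turns coassociativity
into the action law x · (y · f) = (xy) · f, which is associativity of H. Generalised elements of H*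
as a comonoid become available only after this law is known, hence the diagrammatic proof. -/
lemma dualCop_comul_assoc :
    (dualCop H Hd).comul ≫ Hd ◁ (dualCop H Hd).comul =
      (dualCop H Hd).comul ≫ (dualCop H Hd).comul ▷ Hd ≫ (α_ Hd Hd Hd).hom := by
  have h₁ : H ◁ ((dualCop H Hd).comul ≫ Hd ◁ (dualCop H Hd).comul) ≫ evalFst H Hd (Hd ⊗ Hd) =
      dualAct H Hd ≫ (dualCop H Hd).comul := by
    rw [whiskerLeft_comp, Category.assoc, ← evalFst_naturality, whiskerLeft_dualCop_comul_assoc]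
  have h₂ : H ◁ ((dualCop H Hd).comul ≫ (dualCop H Hd).comul ▷ Hd ≫ (α_ Hd Hd Hd).hom) ≫
      evalFst H Hd (Hd ⊗ Hd) =
      H ◁ (dualCop H Hd).comul ≫ (α_ H Hd Hd).inv ≫ dualAct H Hd ▷ Hd := by
    rw [← whiskerLeft_dualCop_comul]
    simp only [evalFst]
    monoidal
  have h₃ : H ◁ dualAct H Hd ≫ dualAct H Hd = (α_ H H Hd).inv ≫ μ[H] ▷ Hd ≫ dualAct H Hd := by
    apply eq_of_whiskerLeft_evaluation (H := H)
    rw [whiskerLeft_comp, Category.assoc, whiskerLeft_dualAct, whiskerLeft_comp, whiskerLeft_comp,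
      Category.assoc, Category.assoc, whiskerLeft_dualAct]
    trans (α_ H H (H ⊗ Hd)).inv ≫ (H ⊗ H) ◁ dualAct H Hd ≫ μ[H] ▷ Hd ≫ evaluation Hd H
    · simp
    · rw [whisker_exchange_assoc, whiskerLeft_dualAct]
      trans (α_ H H (H ⊗ Hd)).inv ≫ (α_ (H ⊗ H) H Hd).inv ≫ (μ[H] ▷ H ≫ μ[H]) ▷ Hd ≫
        evaluation Hd H
      · monoidal
      · rw [MonObj.mul_assoc]
        monoidal
  apply eq_of_whiskerLeft_evalFst (H := H)
  rw [h₁, h₂]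
  apply eq_of_whiskerLeft_evalFst (H := H)
  have h₄ : H ◁ (H ◁ (dualCop H Hd).comul ≫ (α_ H Hd Hd).inv ≫ dualAct H Hd ▷ Hd) ≫
      evalFst H Hd Hd = (α_ H H Hd).inv ≫ μ[H] ▷ Hd ≫ dualAct H Hd := by
    trans H ◁ H ◁ (dualCop H Hd).comul ≫ H ◁ (α_ H Hd Hd).inv ≫ (α_ H (H ⊗ Hd) Hd).inv ≫
      (H ◁ dualAct H Hd ≫ evaluation Hd H) ▷ Hd ≫ (λ_ Hd).hom
    · simp only [evalFst]
      monoidal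
    · rw [whiskerLeft_dualAct, ← whiskerLeft_dualCop_comul]
      trans (α_ H H Hd).inv ≫ ((H ⊗ H) ◁ (dualCop H Hd).comul ≫ μ[H] ▷ (Hd ⊗ Hd)) ≫
        (α_ H Hd Hd).inv ≫ evaluation Hd H ▷ Hd ≫ (λ_ Hd).hom
      · monoidal
      · rw [whisker_exchange]
        simp [evalFst]
  rw [h₄, whiskerLeft_comp, Category.assoc, whiskerLeft_dualCop_comul, h₃]

lemma dualCop_counit_comul :
    (dualCop H Hd).comul ≫ (dualCop H Hd).counit ▷ Hd = (λ_ Hd).inv := by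
  have h : (dualCop H Hd).comul ≫ (dualCop H Hd).counit ▷ Hd ≫ (λ_ Hd).hom =
      (λ_ Hd).inv ≫ η[H] ▷ Hd ≫ dualAct H Hd := by
    rw [← whiskerLeft_dualCop_comul]
    have h' : (dualCop H Hd).counit = (λ_ Hd).inv ≫ η[H] ▷ Hd ≫ evaluation Hd H := rfl
    rw [← whisker_exchange_assoc, h']
    simp only [evalFst]
    monoidal
  rw [← cancel_mono (λ_ Hd).hom, Category.assoc, h, Iso.inv_hom_id]
  apply eq_of_whiskerLeft_evaluation (H := H)
  rw [whiskerLeft_comp, whiskerLeft_comp, Category.assoc, Category.assoc, whiskerLeft_dualAct]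
  trans ((ρ_ H).inv ≫ H ◁ η[H] ≫ μ[H]) ▷ Hd ≫ evaluation Hd H
  · monoidal
  · simp

lemma dualCop_comul_counit :
    (dualCop H Hd).comul ≫ Hd ◁ (dualCop H Hd).counit = (ρ_ Hd).inv := by
  apply eq_of_whiskerLeft_evalFst (H := H)
  rw [whiskerLeft_comp, Category.assoc, ← evalFst_naturality, whiskerLeft_dualCop_comul_assoc]
  trans dualAct H Hd ≫ (λ_ Hd).inv ≫ η[H] ▷ Hd ≫ evaluation Hd H
  · rfl
  · rw [← Category.comp_id (ρ_ Hd).inv, ← Category.id_comp (ρ_ Hd).inv, Category.assoc,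
      Category.comp_id, whiskerLeft_rightUnitor_inv_evalFst, leftUnitor_inv_naturality_assoc,
      whisker_exchange_assoc, whiskerLeft_dualAct]
    trans (((λ_ H).inv ≫ η[H] ▷ H ≫ μ[H]) ▷ Hd) ≫ evaluation Hd H
    · monoidal
    · simp

end DualData

/-! ### The scalar-valued pairing of generalised elements. -/

section Bracket

variable {C : Type u} [Category.{v} C] [MonoidalCategory C] [SymmetricCategory C]
variable {H Hd : C} [ExactPairing Hd H] {Z Z' : C} [ComonObj Z] [ComonObj Z']

/-- The evaluation of generalised elements. -/
def bracket (h : Z ⟶ H) (f : Z ⟶ Hd) : Z ⟶ 𝟙_ C := pair h f ≫ evaluation Hd H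

omit [SymmetricCategory C] in
lemma comp_bracket (s : Z' ⟶ Z) [IsComonHom s] (h : Z ⟶ H) (f : Z ⟶ Hd) :
    s ≫ bracket h f = bracket (s ≫ h) (s ≫ f) :=
  comp_pair_assoc ..

instance {W : C} (h : Z ⟶ H) (f : Z ⟶ Hd) (w : Z ⟶ W) [Swap h w] [Swap f w] :
    Swap (bracket h f) w :=
  inferInstanceAs (Swap (pair h f ≫ evaluation Hd H) w)

omit [SymmetricCategory C] in
lemma scalar_one_def : (1 : Z ⟶ 𝟙_ C) = ε[Z] := Category.comp_id _

lemma pair_scalar_leftUnitor_eq {X : C} (y : Z ⟶ H) (σ : Z ⟶ 𝟙_ C) (v : Z ⟶ X) [Swap y σ] :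
    pair y (pair σ v ≫ (λ_ X).hom) = pair σ (pair y v) ≫ (λ_ (H ⊗ X)).hom := by
  have h : pair σ (pair y v) = pair y (pair σ v) ≫ (α_ H (𝟙_ C) X).inv ≫
      (β_ H (𝟙_ C)).hom ▷ X ≫ (α_ (𝟙_ C) H X).hom := by
    simp only [pair_associator_inv_assoc, pair_whiskerRight_assoc, Swap.swap, pair_associator_hom]
  rw [h, ← pair_whiskerLeft]
  simp

lemma bracket_scalar (y : Z ⟶ H) (σ : Z ⟶ 𝟙_ C) (v : Z ⟶ Hd) [Swap y σ] :
    bracket y (pair σ v ≫ (λ_ Hd).hom) = σ * bracket y v := by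
  rw [bracket, pair_scalar_leftUnitor_eq, Category.assoc, ← leftUnitor_naturality,
    pair_whiskerLeft_assoc]
  rfl

omit [SymmetricCategory C] in
lemma pair_evalFst (x : Z ⟶ H) (f : Z ⟶ Hd) {X : C} (v : Z ⟶ X) :
    pair x (pair f v) ≫ evalFst H Hd X = pair (bracket x f) v ≫ (λ_ X).hom := by
  simp [evalFst, bracket]

lemma eq_of_bracket [ComonObj H] {u v : Z ⟶ Hd}
    (h : ∀ {W : C} [ComonObj W] (x : W ⟶ H) (z : W ⟶ Z) [IsComonHom x] [IsComonHom z] [Swap x z],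
      bracket x (z ≫ u) = bracket x (z ≫ v)) : u = v := by
  apply eq_of_whiskerLeft_evaluation (H := H)
  refine ext_tensor fun x z _ _ _ => ?_
  rw [pair_whiskerLeft_assoc, pair_whiskerLeft_assoc]
  exact h x z

lemma eq_of_bracket_evalFst [ComonObj H] {u v : Z ⟶ Hd ⊗ Hd}
    (h : ∀ {W : C} [ComonObj W] (y x : W ⟶ H) (z : W ⟶ Z) [IsComonHom y] [IsComonHom x]
      [IsComonHom z] [Swap y x] [Swap y z] [Swap x z],
      bracket y (pair x (z ≫ u) ≫ evalFst H Hd Hd) =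
        bracket y (pair x (z ≫ v) ≫ evalFst H Hd Hd)) : u = v := by
  apply eq_of_whiskerLeft_evalFst (H := H)
  refine eq_of_bracket (H := H) fun y w _ _ _ => ?_
  rw [eq_pair_comp_fst_snd w, pair_whiskerLeft_assoc, pair_whiskerLeft_assoc]
  exact h y _ _

end Bracket

section DualComon

variable {C : Type u} [Category.{v} C] [MonoidalCategory C] [SymmetricCategory C]
variable (H Hd : C) [HopfObj H] [IsIso 𝒮[H]] [ExactPairing Hd H]

/-- The comonoid structure on `Hd` is that of the dual. -/
class IsDualComon [ComonObj Hd] : Prop where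
  counit_eq : ε[Hd] = (dualCop H Hd).counit
  comul_eq : Δ[Hd] = (dualCop H Hd).comul

variable {H Hd} [ComonObj Hd] [IsDualComon H Hd] {Z Z' : C} [ComonObj Z] [ComonObj Z']

/-- Here x pairs with the first leg and y with the second: this is the opposite coproduct coming
from H^cop. -/
lemma bracket_comul (y x : Z ⟶ H) (f : Z ⟶ Hd) :
    bracket y (pair x (f ≫ Δ[Hd]) ≫ evalFst H Hd Hd) = bracket (y * x) f := by
  rw [IsDualComon.comul_eq (H := H), ← pair_whiskerLeft_assoc, whiskerLeft_dualCop_comul, bracket,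
    ← pair_whiskerLeft_assoc, whiskerLeft_dualAct, pair_associator_inv_assoc,
    pair_whiskerRight_assoc]
  rfl

lemma bracket_mul_left_of_swap (y x : Z ⟶ H) (f : Z ⟶ Hd) [IsComonHom f] [Swap y x] [Swap y f] :
    bracket (y * x) f = bracket x f * bracket y f := by
  rw [← bracket_comul, comp_comul, pair_evalFst, bracket_scalar]

lemma isCommComonObj_dual [IsCommMonObj H] : IsCommComonObj Hd where
  comul_comm := by
    -- Exchanging the two factors of H* amounts to exchanging y and x. It is proved as an identity
    -- of morphisms so that it also applies to the coproduct of f, whose legs are not yet known to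
    -- be exchangeable.
    have h : H ◁ H ◁ (β_ Hd Hd).hom ≫ H ◁ evalFst H Hd Hd ≫ evaluation Hd H =
        (α_ H H (Hd ⊗ Hd)).inv ≫ (β_ H H).hom ▷ (Hd ⊗ Hd) ≫ (α_ H H (Hd ⊗ Hd)).hom ≫
          H ◁ evalFst H Hd Hd ≫ evaluation Hd H := by
      refine ext_tensor fun y w _ _ _ => ?_
      rw [eq_pair_comp_fst_snd w, eq_pair_comp_fst_snd (w ≫ snd _ _)]
      simp only [pair_whiskerLeft_assoc, pair_whiskerLeft, Swap.swap, pair_associator_inv_assoc,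
        pair_associator_hom_assoc, pair_whiskerRight_assoc, pair_evalFst]
      change bracket _ _ = bracket _ _
      rw [bracket_scalar, bracket_scalar, hom_mul_comm]
    refine eq_of_bracket_evalFst (H := H) fun y x f _ _ _ _ _ _ => ?_
    have h' := pair y (pair x (f ≫ Δ[Hd])) ≫= h
    simp only [pair_whiskerLeft_assoc, pair_whiskerLeft, Swap.swap, pair_associator_inv_assoc,
      pair_associator_hom_assoc, pair_whiskerRight_assoc] at h'
    rw [← Category.assoc]
    refine h'.trans ?_
    change bracket _ _ = bracket _ _
    rw [bracket_comul, bracket_comul, hom_mul_comm]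

/-- No exchange of y and x is required, so both may come from the same element of H. The identity is
checked on independent elements, read as an equality of morphisms, and then evaluated at arbitrary y
and x; later proofs reuse this device. -/
lemma bracket_mul_left [IsCommComonObj Hd] (y x : Z ⟶ H) (f : Z ⟶ Hd) [IsComonHom f] [Swap x f] :
    bracket (y * x) f = bracket y f * bracket x f := by
  have h : μ[H] ▷ Hd ≫ evaluation Hd H =
      (H ⊗ H) ◁ Δ[Hd] ≫ tensorμ H H Hd Hd ≫ (evaluation Hd H ⊗ₘ evaluation Hd H) ≫
        (λ_ (𝟙_ C)).hom := by
    refine ext_tensor fun w f _ _ _ => ?_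
    rw [eq_pair_comp_fst_snd w, pair_whiskerLeft_assoc, comp_comul, pair_tensorμ_assoc,
      pair_tensorHom_assoc, pair_whiskerRight_assoc]
    exact (bracket_mul_left_of_swap _ _ f).trans (hom_mul_comm _ _)
  have h' := pair (pair y x) f ≫= h
  rw [pair_whiskerRight_assoc, pair_whiskerLeft_assoc, comp_comul, pair_tensorμ_assoc,
    pair_tensorHom_assoc] at h'
  exact h'

lemma bracket_scalar_left (σ : Z ⟶ 𝟙_ C) (f : Z ⟶ Hd) [IsComonHom f] :
    bracket (σ ≫ η[H]) f = σ := by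
  have h : η[H] ▷ Hd ≫ evaluation Hd H = (λ_ Hd).hom ≫ ε[Hd] := by
    rw [IsDualComon.counit_eq (H := H)]
    simp [dualCop]
  rw [bracket, ← pair_whiskerRight_assoc, h, ← leftUnitor_naturality, pair_whiskerLeft_assoc,
    IsComonHom.hom_counit, unitors_equal, pair_counit_rightUnitor]

lemma bracket_one_left (f : Z ⟶ Hd) [IsComonHom f] : bracket (1 : Z ⟶ H) f = 1 := by
  rw [hom_one_def, bracket_scalar_left, scalar_one_def]

end DualComon

/-! ### The dual as a Hopf algebra. -/

section DualHopf

variable {C : Type u} [Category.{v} C] [MonoidalCategory C] [SymmetricCategory C]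

section

variable (H Hd : C) [HopfObj H] [IsIso 𝒮[H]] [ExactPairing Hd H]

/-- The comonoid structure on the dual. -/
@[reducible]
noncomputable def dualComonObj : ComonObj Hd where
  counit := (dualCop H Hd).counit
  comul := (dualCop H Hd).comul
  counit_comul := dualCop_counit_comul H Hd
  comul_counit := dualCop_comul_counit H Hd
  comul_assoc := dualCop_comul_assoc H Hd

end

variable {H Hd : C} [HopfObj H] [IsIso 𝒮[H]] [ExactPairing Hd H] [ComonObj Hd] [IsDualComon H Hd]
variable {Z : C} [ComonObj Z]

omit [IsDualComon H Hd] in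
lemma bracket_dualCop_mul (h : Z ⟶ H) (f g : Z ⟶ Hd) [IsComonHom h] [Swap h f] :
    bracket h (pair f g ≫ (dualCop H Hd).mul) = bracket h f * bracket h g := by
  have e : (β_ H H).hom ▷ (Hd ⊗ Hd) ≫ (α_ H H (Hd ⊗ Hd)).hom ≫ H ◁ (α_ H Hd Hd).inv ≫
      H ◁ (evaluation Hd H ▷ Hd ≫ (λ_ Hd).hom) ≫ evaluation Hd H =
      tensorμ H H Hd Hd ≫ (evaluation Hd H ⊗ₘ evaluation Hd H) ≫ (λ_ (𝟙_ C)).hom := by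
    refine ext_tensor fun w z _ _ _ => ?_
    rw [eq_pair_comp_fst_snd w, eq_pair_comp_fst_snd z]
    simp only [pair_whiskerRight_assoc, Swap.swap, pair_associator_hom_assoc,
      pair_whiskerLeft_assoc, pair_associator_inv, pair_tensorμ_assoc, pair_tensorHom_assoc]
    exact bracket_scalar _ (bracket _ _) _
  have e' := pair (pair h h) (pair f g) ≫= e
  rw [pair_tensorμ_assoc, pair_tensorHom_assoc] at e'
  refine Eq.trans ?_ e'
  rw [bracket, ← pair_whiskerLeft_assoc, whiskerLeft_dualCop_mul, pair_whiskerRight_assoc,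
    ← Category.assoc h, comp_comul, pair_whiskerRight_assoc]

omit [ComonObj Hd] [IsDualComon H Hd] in
lemma bracket_dualCop_one (h : Z ⟶ H) [IsComonHom h] :
    bracket h (ε[Z] ≫ (dualCop H Hd).one) = 1 := by
  rw [bracket, ← pair_whiskerLeft_assoc, whiskerLeft_dualCop_one,
    pair_counit_rightUnitor_assoc, IsComonHom.hom_counit, scalar_one_def]

omit [ComonObj Hd] [IsDualComon H Hd] in
lemma bracket_dualCop_antipode (h : Z ⟶ H) (f : Z ⟶ Hd) :
    bracket h (f ≫ (dualCop H Hd).antipode) = bracket (h ≫ inv 𝒮[H]) f := by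
  rw [bracket, ← pair_whiskerLeft_assoc, whiskerLeft_dualCop_antipode, pair_whiskerRight_assoc]
  rfl

lemma comp_counit_dual (f : Z ⟶ Hd) : f ≫ ε[Hd] = bracket (1 : Z ⟶ H) f := by
  have h : ε[Hd] = (λ_ Hd).inv ≫ η[H] ▷ Hd ≫ evaluation Hd H :=
    IsDualComon.counit_eq (H := H)
  rw [h, ← Category.assoc, comp_leftUnitor_inv, pair_whiskerRight_assoc]
  rfl

/-- The bialgebra law of H enters because y * x is again a comonoid morphism, so ⟨yx, fg⟩ = ⟨yx,
f⟩⟨yx, g⟩; the four resulting scalars are then reordered. -/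
lemma bracket_dualCop_mul_comul (y x : Z ⟶ H) (f g : Z ⟶ Hd) [IsComonHom y] [IsComonHom x]
    [IsComonHom f] [IsComonHom g] [Swap y x] [Swap y f] [Swap y g] [Swap x f] [Swap x g]
    [Swap f g] :
    bracket y (pair x (pair f g ≫ (dualCop H Hd).mul ≫ Δ[Hd]) ≫ evalFst H Hd Hd) =
      bracket y (pair x (pair f g ≫ pair (dualCop H Hd).mul (dualCop H Hd).mul) ≫
        evalFst H Hd Hd) := by
  rw [← Category.assoc (pair f g), bracket_comul, bracket_dualCop_mul, comp_pair, pair_evalFst,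
    bracket_scalar, bracket_dualCop_mul, bracket_dualCop_mul, bracket_mul_left_of_swap,
    bracket_mul_left_of_swap, mul_assoc, mul_assoc, ← mul_assoc (bracket y f),
    hom_mul_comm (bracket y f), mul_assoc]

variable (H Hd) in
lemma isComonHom_dualCop_mul : IsComonHom (dualCop H Hd).mul := by
  refine isComonHom_of_pair _ ?_ ?_
  · refine ext_tensor fun f g _ _ _ => ?_
    rw [← Category.assoc, comp_counit_dual (H := H), bracket_dualCop_mul, bracket_one_left,
      bracket_one_left, one_mul, IsComonHom.hom_counit, scalar_one_def]
  · refine eq_of_bracket_evalFst (H := H) fun y x z _ _ _ _ _ _ => ?_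
    rw [eq_pair_comp_fst_snd z]
    exact bracket_dualCop_mul_comul ..

section

attribute [local instance] ComonObj.instTensorUnit

variable (H Hd) in
lemma dualCop_one_counit : (dualCop H Hd).one ≫ ε[Hd] = 𝟙 (𝟙_ C) := by
  rw [comp_counit_dual (H := H), ← Category.id_comp (dualCop H Hd).one]
  exact (bracket_dualCop_one (Z := 𝟙_ C) (1 : 𝟙_ C ⟶ H)).trans scalar_one_def

variable (H Hd) in
lemma dualCop_one_comul :
    (dualCop H Hd).one ≫ Δ[Hd] = (λ_ (𝟙_ C)).inv ≫ ((dualCop H Hd).one ⊗ₘ (dualCop H Hd).one) := by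
  change _ = pair (dualCop H Hd).one (dualCop H Hd).one
  refine eq_of_bracket_evalFst (H := H) fun y x z _ _ _ _ _ _ => ?_
  have hz : z = ε := (Category.comp_id z).symm.trans (IsComonHom.hom_counit z)
  rw [← Category.assoc, bracket_comul, comp_pair, hz, pair_evalFst, bracket_scalar,
    bracket_dualCop_one, bracket_dualCop_one, bracket_dualCop_one, one_mul]

end

variable (H Hd) in
omit [IsDualComon H Hd] in
lemma dualCop_one_mul :
    (dualCop H Hd).one ▷ Hd ≫ (dualCop H Hd).mul = (λ_ Hd).hom := by
  rw [← cancel_epi (λ_ _).inv, Iso.inv_hom_id, leftUnitor_inv_eq_pair, pair_whiskerRight_assoc]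
  refine eq_of_bracket (H := H) fun x z _ _ _ => ?_
  rw [comp_pair_assoc, ← Category.assoc z, IsComonHom.hom_counit, bracket_dualCop_mul,
    bracket_dualCop_one, one_mul]

variable (H Hd) in
omit [IsDualComon H Hd] in
lemma dualCop_mul_one :
    Hd ◁ (dualCop H Hd).one ≫ (dualCop H Hd).mul = (ρ_ Hd).hom := by
  rw [← cancel_epi (ρ_ _).inv, Iso.inv_hom_id, rightUnitor_inv_eq_pair, pair_whiskerLeft_assoc]
  refine eq_of_bracket (H := H) fun x z _ _ _ => ?_
  rw [comp_pair_assoc, ← Category.assoc z, IsComonHom.hom_counit, Category.comp_id,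
    bracket_dualCop_mul, bracket_dualCop_one, mul_one]

variable (H Hd) in
omit [IsDualComon H Hd] in
lemma dualCop_mul_assoc :
    (dualCop H Hd).mul ▷ Hd ≫ (dualCop H Hd).mul =
      (α_ Hd Hd Hd).hom ≫ Hd ◁ (dualCop H Hd).mul ≫ (dualCop H Hd).mul := by
  refine eq_of_bracket (H := H) fun x z _ _ _ => ?_
  rw [eq_pair_comp_fst_snd z, eq_pair_comp_fst_snd (z ≫ fst _ _)]
  rw [pair_whiskerRight_assoc, pair_associator_hom_assoc, pair_whiskerLeft_assoc]
  rw [bracket_dualCop_mul, bracket_dualCop_mul, bracket_dualCop_mul, bracket_dualCop_mul, mul_assoc]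

lemma inv_antipode [IsCommMonObj H] : inv 𝒮[H] = 𝒮[H] :=
  IsIso.inv_eq_of_hom_inv_id (HopfObj.antipode_antipode H (IsCommMonObj.mul_comm H))

variable (H Hd) in
-- Pairing with x gives ⟨λ(x₁) x₂, f⟩ = ε(x) ε(f), using λ⁻¹ = λ and cocommutativity of the dual.
lemma dualCop_antipode_left [IsCommMonObj H] :
    Δ[Hd] ≫ (dualCop H Hd).antipode ▷ Hd ≫ (dualCop H Hd).mul = ε[Hd] ≫ (dualCop H Hd).one := by
  have := isCommComonObj_dual (H := H) (Hd := Hd)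
  refine eq_of_bracket (H := H) fun x z _ _ _ => ?_
  rw [← Category.assoc z, comp_comul, pair_whiskerRight_assoc, bracket_dualCop_mul,
    bracket_dualCop_antipode, ← bracket_mul_left, inv_antipode, comp_antipode_mul_self,
    bracket_one_left, ← Category.assoc z, IsComonHom.hom_counit, bracket_dualCop_one]

variable (H Hd) in
lemma dualCop_antipode_right [IsCommMonObj H] :
    Δ[Hd] ≫ Hd ◁ (dualCop H Hd).antipode ≫ (dualCop H Hd).mul = ε[Hd] ≫ (dualCop H Hd).one := by
  have := isCommComonObj_dual (H := H) (Hd := Hd)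
  refine eq_of_bracket (H := H) fun x z _ _ _ => ?_
  rw [← Category.assoc z, comp_comul, pair_whiskerLeft_assoc, bracket_dualCop_mul,
    bracket_dualCop_antipode, ← bracket_mul_left, inv_antipode, self_mul_comp_antipode,
    bracket_one_left, ← Category.assoc z, IsComonHom.hom_counit, bracket_dualCop_one]

end DualHopf

section

variable {C : Type u} [Category.{v} C] [MonoidalCategory C] [SymmetricCategory C]
variable (H Hd : C) [HopfObj H] [IsCommMonObj H] [ExactPairing Hd H]

/-- The Hopf algebra structure on the dual of a commutative Hopf algebra. -/
@[reducible]
noncomputable def dualHopfObj : HopfObj Hd :=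
  letI := dualComonObj H Hd
  haveI : IsDualComon H Hd := ⟨rfl, rfl⟩
  { dualComonObj H Hd with
    one := (dualCop H Hd).one
    mul := (dualCop H Hd).mul
    antipode := (dualCop H Hd).antipode
    one_mul := dualCop_one_mul H Hd
    mul_one := dualCop_mul_one H Hd
    mul_assoc := dualCop_mul_assoc H Hd
    mul_comul := by
      rw [← Category.assoc, ← Comon.tensorObj_comul]
      exact (isComonHom_dualCop_mul H Hd).hom_comul
    one_comul := dualCop_one_comul H Hd
    mul_counit := (isComonHom_dualCop_mul H Hd).hom_counit
    one_counit := dualCop_one_counit H Hd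
    antipode_left := dualCop_antipode_left H Hd
    antipode_right := dualCop_antipode_right H Hd }

end

/-! ### The two actions of the double: the left one is trivial, the right one is a conjugation. -/

section Action

variable {C : Type u} [Category.{v} C] [MonoidalCategory C] [SymmetricCategory C]
variable {H Hd : C} [HopfObj H] [IsCommMonObj H] [ExactPairing Hd H]

lemma doubleR_eq_fst : doubleR H = fst H H := by
  refine ext_tensor fun x h _ _ _ => ?_
  rw [doubleR, inv_antipode, IsCommMonObj.mul_comm, pair_whiskerLeft_assoc, comp_comul,
    pair_associator_inv_assoc, pair_tensorHom_assoc, pair_fst]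
  change (x * h) * (h ≫ 𝒮[H]) = x
  rw [mul_assoc, self_mul_comp_antipode, mul_one]

lemma doubleLeftAction_eq_snd : doubleLeftAction H Hd = snd H Hd := by
  apply eq_of_whiskerLeft_evaluation (H := H)
  rw [whiskerLeft_doubleLeftAction, doubleR_eq_fst]
  simp only [fst, snd]
  monoidal

variable (H Hd) in
/-- The Hopf algebra structure on `Hd` is that of the dual. -/
class IsDualHopf [h : HopfObj Hd] : Prop where
  ofHopfObj_eq : HopfData.ofHopfObj h = dualCop H Hd

variable [hd : HopfObj Hd] [IsDualHopf H Hd]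

instance : IsDualComon H Hd where
  counit_eq := congrArg HopfData.counit (IsDualHopf.ofHopfObj_eq (H := H) (Hd := Hd))
  comul_eq := congrArg HopfData.comul (IsDualHopf.ofHopfObj_eq (H := H) (Hd := Hd))

variable {Z : C} [ComonObj Z]

lemma bracket_mul_right (h : Z ⟶ H) (f g : Z ⟶ Hd) [IsComonHom h] [Swap h f] :
    bracket h (f * g) = bracket h f * bracket h g := by
  have e : μ[Hd] = (dualCop H Hd).mul := congrArg HopfData.mul IsDualHopf.ofHopfObj_eq
  rw [hom_mul_def, e, bracket_dualCop_mul]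

lemma bracket_one_right (h : Z ⟶ H) [IsComonHom h] : bracket h (1 : Z ⟶ Hd) = 1 := by
  have e : η[Hd] = (dualCop H Hd).one := congrArg HopfData.one IsDualHopf.ofHopfObj_eq
  rw [hom_one_def, e, bracket_dualCop_one]

lemma bracket_antipode (h : Z ⟶ H) (f : Z ⟶ Hd) :
    bracket (h ≫ 𝒮[H]) f = bracket h (f ≫ 𝒮[Hd]) := by
  have e : 𝒮[Hd] = (dualCop H Hd).antipode := congrArg HopfData.antipode IsDualHopf.ofHopfObj_eq
  rw [e, bracket_dualCop_antipode, inv_antipode]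

/-- The evaluation of generalised elements, as a multiple of the unit of `H`. -/
def unitBracket (h : Z ⟶ H) (f : Z ⟶ Hd) : Z ⟶ H := bracket h f ≫ η[H]

instance {W : C} (h : Z ⟶ H) (f : Z ⟶ Hd) (w : Z ⟶ W) [Swap h w] [Swap f w] :
    Swap (unitBracket h f) w :=
  inferInstanceAs (Swap (bracket h f ≫ η[H]) w)

omit [IsCommMonObj H] in
instance isMonHom_one : IsMonHom η[H] where
  mul_hom := by simp [unitors_equal]

omit [IsCommMonObj H] hd [IsDualHopf H Hd] in
lemma comp_unitBracket {Z' : C} [ComonObj Z'] (s : Z' ⟶ Z) [IsComonHom s] (h : Z ⟶ H)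
    (f : Z ⟶ Hd) : s ≫ unitBracket h f = unitBracket (s ≫ h) (s ≫ f) := by
  rw [unitBracket, ← Category.assoc, comp_bracket, unitBracket]

lemma unitBracket_mul_right (h : Z ⟶ H) (f g : Z ⟶ Hd) [IsComonHom h] [Swap h f] :
    unitBracket h (f * g) = unitBracket h f * unitBracket h g := by
  rw [unitBracket, bracket_mul_right, mul_comp]; rfl

lemma unitBracket_one_right (h : Z ⟶ H) [IsComonHom h] : unitBracket h (1 : Z ⟶ Hd) = 1 := by
  rw [unitBracket, bracket_one_right, one_comp]

lemma unitBracket_one_left (f : Z ⟶ Hd) [IsComonHom f] : unitBracket (1 : Z ⟶ H) f = 1 := by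
  rw [unitBracket, bracket_one_left, one_comp]

lemma unitBracket_unitBracket (h : Z ⟶ H) (f g : Z ⟶ Hd) [IsComonHom g] :
    unitBracket (unitBracket h f) g = unitBracket h f := by
  rw [unitBracket, unitBracket, bracket_scalar_left]

omit [IsCommMonObj H] in
lemma mul_scalar_comp_one (y : Z ⟶ H) (σ : Z ⟶ 𝟙_ C) :
    y * (σ ≫ η[H]) = pair y σ ≫ (ρ_ H).hom := by
  rw [hom_mul_def, ← pair_whiskerLeft, Category.assoc, MonObj.mul_one]

section

variable [IsCommComonObj Hd]

lemma unitBracket_mul_left (y x : Z ⟶ H) (f : Z ⟶ Hd) [IsComonHom f] [Swap x f] :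
    unitBracket (y * x) f = unitBracket y f * unitBracket x f := by
  rw [unitBracket, bracket_mul_left, mul_comp]; rfl

omit [IsCommComonObj Hd] in
lemma unitBracket_antipode_mul_unitBracket (h : Z ⟶ H) (f : Z ⟶ Hd) [IsComonHom h]
    [IsComonHom f] [Swap h f] : unitBracket h (f ≫ 𝒮[Hd]) * unitBracket h f = 1 := by
  rw [← unitBracket_mul_right, comp_antipode_mul_self, unitBracket_one_right]

/-- On generalised elements, the right action of the dual is `ψ (h ⊗ f) = ⟨h₁, f₁⟩ h₂ ⟨h₃, λ f₂⟩`. -/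
lemma pair_doubleRightAction (h : Z ⟶ H) (f : Z ⟶ Hd) [IsComonHom h] [IsComonHom f] [Swap h f] :
    pair h f ≫ doubleRightAction H Hd = unitBracket h f * h * unitBracket h (f ≫ 𝒮[Hd]) := by
  let L : H ⊗ Hd ⟶ H := fst H Hd * unitBracket (fst H Hd) (snd H Hd ≫ 𝒮[Hd])
  have hL {W : C} [ComonObj W] (y : W ⟶ H) (f : W ⟶ Hd) [IsComonHom y] [IsComonHom f]
      [Swap y f] : pair y f ≫ L = y * unitBracket y (f ≫ 𝒮[Hd]) := by
    rw [comp_mul, comp_unitBracket, pair_fst, pair_snd_assoc]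
  -- Independent x and y replace h₁ and the remaining legs h₂, h₃. They are exchangeable although
  -- the legs of one h are not; evaluating at `pair h h` afterwards recovers the claim.
  have e : ((β_ H H).hom ≫ Δ[H] ▷ H ≫ (α_ H H H).hom ≫ H ◁ (𝒮[H] ▷ H ≫ μ[H])) ▷ Hd ≫
      (α_ H H Hd).hom ≫ H ◁ evaluation Hd H ≫ (ρ_ H).hom =
      (H ⊗ H) ◁ Δ[Hd] ≫ tensorμ H H Hd Hd ≫ ((evaluation Hd H ≫ η[H]) ⊗ₘ L) ≫ μ[H] := by
    refine ext_tensor fun w f _ _ _ => ?_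
    rw [eq_pair_comp_fst_snd w]
    generalize hx : w ≫ fst H H = x
    generalize hy : w ≫ snd H H = y
    have : IsComonHom y := hy ▸ inferInstance
    have : Swap x y := hy ▸ hx ▸ inferInstance
    have : Swap x f := hx ▸ inferInstance
    have : Swap y f := hy ▸ inferInstance
    rw [pair_whiskerRight_assoc, pair_whiskerLeft_assoc, comp_comul, pair_tensorμ_assoc,
      pair_tensorHom_assoc, hL, Swap.swap_assoc, pair_whiskerRight_assoc, comp_comul,
      pair_associator_hom_assoc, pair_whiskerLeft, pair_whiskerRight_assoc,
      pair_associator_hom_assoc, pair_whiskerLeft_assoc, ← Category.assoc (pair x f)]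
    change pair y (bracket ((y ≫ 𝒮[H]) * x) f) ≫ _ =
      unitBracket x f * (y * unitBracket y (f ≫ 𝒮[Hd]))
    rw [← mul_scalar_comp_one]
    change y * unitBracket _ _ = _
    rw [hom_mul_comm (y ≫ 𝒮[H]), unitBracket_mul_left, unitBracket, unitBracket, bracket_antipode,
      ← mul_assoc, ← mul_assoc, hom_mul_comm y]
    rfl
  have e' := pair (pair h h) f ≫= e
  rw [pair_whiskerLeft_assoc (pair h h), comp_comul f, pair_tensorμ_assoc, pair_tensorHom_assoc,
    hL, ← Category.assoc (pair h f)] at e'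
  rw [mul_assoc]
  refine Eq.trans ?_ e'
  rw [← comp_comul h, doubleRightAction, doubleRbar, inv_antipode]
  simp

omit [IsCommMonObj H] in
instance isMonHom_counit : IsMonHom ε[H] where

omit [IsCommMonObj H] in
instance isMonHom_comul : IsMonHom Δ[H] where
  mul_hom := by simp [MonObj.tensorObj.mul_def]

omit [IsCommMonObj H] in
lemma pair_scalar_one (σ : Z ⟶ 𝟙_ C) : pair (σ ≫ η[H]) (1 : Z ⟶ H) = (σ ≫ η[H]) ≫ Δ[H] := by
  have h : pair (σ ≫ η[H]) (1 : Z ⟶ H) = pair σ ε[Z] ≫ (η[H] ⊗ₘ η[H]) := by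
    rw [pair_tensorHom]; rfl
  rw [h, ← comp_rightUnitor_inv, ← unitors_inv_equal]
  simp [MonObj.tensorObj.one_def]

omit [IsCommMonObj H] in
lemma pair_one_scalar (σ : Z ⟶ 𝟙_ C) : pair (1 : Z ⟶ H) (σ ≫ η[H]) = (σ ≫ η[H]) ≫ Δ[H] := by
  have h : pair (1 : Z ⟶ H) (σ ≫ η[H]) = pair ε[Z] σ ≫ (η[H] ⊗ₘ η[H]) := by
    rw [pair_tensorHom]; rfl
  rw [h, ← comp_leftUnitor_inv]
  simp [MonObj.tensorObj.one_def]

omit [IsCommMonObj H] in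
lemma pair_eq_mul (x y : Z ⟶ H) : pair x y = pair x 1 * pair 1 y := by
  rw [pair_mul_pair, mul_one, one_mul]

/-- Write σ = ⟨h, f⟩ and σ' = ⟨h, λf⟩ as multiples of the unit. Their coproducts may be placed in
either leg, so Δ(σ h σ') = (σ ⊗ 1)(h ⊗ 1)(1 ⊗ h)(1 ⊗ σ'). -/
lemma isComonHom_doubleRightAction : IsComonHom (doubleRightAction H Hd) := by
  set h := fst H Hd
  set f := snd H Hd
  have hψ : doubleRightAction H Hd = unitBracket h f * h * unitBracket h (f ≫ 𝒮[Hd]) := by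
    rw [← pair_doubleRightAction, pair_fst_snd, Category.id_comp]
  refine isComonHom_of_pair _ ?_ ?_
  · rw [hψ, mul_comp, mul_comp, IsComonHom.hom_counit h, unitBracket, unitBracket, Category.assoc,
      Category.assoc, BimonObj.one_counit, Category.comp_id, Category.comp_id, ← scalar_one_def,
      mul_one, ← bracket_mul_right, self_mul_comp_antipode, bracket_one_right]
  · have ha : unitBracket h (f ≫ 𝒮[Hd]) * unitBracket h f = 1 :=
      unitBracket_antipode_mul_unitBracket h f
    have h₁ (g : H ⊗ Hd ⟶ Hd) : unitBracket h g ≫ Δ[H] = pair (unitBracket h g) 1 :=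
      (pair_scalar_one _).symm
    have h₂ (g : H ⊗ Hd ⟶ Hd) : unitBracket h g ≫ Δ[H] = pair 1 (unitBracket h g) :=
      (pair_one_scalar _).symm
    have m₁ (x y : H ⊗ Hd ⟶ H) : pair (x * y) (1 : H ⊗ Hd ⟶ H) = pair x 1 * pair y 1 := by
      rw [pair_mul_pair, mul_one]
    have m₂ (x y : H ⊗ Hd ⟶ H) : pair (1 : H ⊗ Hd ⟶ H) (x * y) = pair 1 x * pair 1 y := by
      rw [pair_mul_pair, mul_one]
    -- This is (σ' ⊗ 1)(1 ⊗ σ) = 1: inserted in the middle, it completes the factors to (ψ ⊗ 1)(1 ⊗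
    -- ψ).
    have hc : pair (unitBracket h (f ≫ 𝒮[Hd])) 1 * pair 1 (unitBracket h f) = 1 := by
      rw [← h₁, h₂, ← m₂, ha, pair_one_one]
    rw [hψ, mul_comp, mul_comp, h₁ f, h₂, comp_comul, pair_eq_mul h h,
      pair_eq_mul (unitBracket h f * h * _), m₁, m₁, m₂, m₂]
    simp only [mul_assoc]
    rw [← mul_assoc (pair (unitBracket h (f ≫ 𝒮[Hd])) 1), hc, one_mul]

lemma mul_comp_antipode {M : C} [HopfObj M] (f g : Z ⟶ M) [Swap f g] :
    (f * g) ≫ 𝒮[M] = (g ≫ 𝒮[M]) * (f ≫ 𝒮[M]) := by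
  rw [hom_mul_def, Category.assoc, HopfObj.mul_antipode, pair_tensorHom_assoc, Swap.swap_assoc]
  rfl

/-- With τ = ⟨u, g⟩ and τ' = ⟨u, λg⟩, acting by f and then g gives (σ τ σ')(σ u σ')(σ τ' σ'). Since
σ' σ = 1 this is σ τ u τ' σ', the action of fg. -/
lemma pair_mul_doubleRightAction (u : Z ⟶ H) (f g : Z ⟶ Hd) [IsComonHom u] [IsComonHom f]
    [IsComonHom g] [Swap u f] [Swap u g] [Swap f g] :
    pair u (f * g) ≫ doubleRightAction H Hd =
      pair (pair u f ≫ doubleRightAction H Hd) g ≫ doubleRightAction H Hd := by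
  have := isComonHom_doubleRightAction (H := H) (Hd := Hd)
  have ha : unitBracket u (f ≫ 𝒮[Hd]) * unitBracket u f = 1 :=
    unitBracket_antipode_mul_unitBracket u f
  have ha' (x : Z ⟶ H) : unitBracket u (f ≫ 𝒮[Hd]) * (unitBracket u f * x) = x := by
    rw [← mul_assoc, ha, one_mul]
  rw [pair_doubleRightAction (pair u f ≫ doubleRightAction H Hd), pair_doubleRightAction u f,
    pair_doubleRightAction, mul_comp_antipode, unitBracket_mul_right, unitBracket_mul_right,
    unitBracket_mul_left, unitBracket_mul_left, unitBracket_mul_left, unitBracket_mul_left]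
  simp only [unitBracket_unitBracket, mul_assoc, ha']

lemma mul_pair_doubleRightAction (y x : Z ⟶ H) (f : Z ⟶ Hd) [IsComonHom y] [IsComonHom x]
    [IsComonHom f] [Swap y x] [Swap y f] [Swap x f] :
    pair (y * x) f ≫ doubleRightAction H Hd =
      (pair y f ≫ doubleRightAction H Hd) * (pair x f ≫ doubleRightAction H Hd) := by
  rw [pair_doubleRightAction, pair_doubleRightAction, pair_doubleRightAction, unitBracket_mul_left,
    unitBracket_mul_left]
  simp only [mul_assoc]
  rw [← mul_assoc (unitBracket x f) y, hom_mul_comm (unitBracket x f) y, mul_assoc,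
    ← mul_assoc x, hom_mul_comm x, mul_assoc, ← mul_assoc (unitBracket x f),
    hom_mul_comm (unitBracket x f), mul_assoc]

lemma isModuleBimon_doubleRightAction : IsModuleBimon (doubleRightAction H Hd) where
  isComonHom := isComonHom_doubleRightAction
  act_mul u f g _ _ _ := by
    have e : H ◁ μ[Hd] ≫ doubleRightAction H Hd = (α_ H Hd Hd).inv ≫
        doubleRightAction H Hd ▷ Hd ≫ doubleRightAction H Hd := by
      refine ext_tensor fun x z _ _ _ => ?_
      rw [eq_pair_comp_fst_snd z, pair_whiskerLeft_assoc, pair_associator_inv_assoc,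
        pair_whiskerRight_assoc]
      exact pair_mul_doubleRightAction ..
    have e' := pair u (pair f g) ≫= e
    rwa [pair_whiskerLeft_assoc, pair_associator_inv_assoc, pair_whiskerRight_assoc] at e'
  act_one u := by
    -- The formula for ψ needs a comonoid morphism, so the identity of H is treated first and
    -- precomposed with an arbitrary u.
    have e : pair (𝟙 H) (1 : H ⟶ Hd) ≫ doubleRightAction H Hd = 𝟙 H := by
      have hS : (1 : H ⟶ Hd) ≫ 𝒮[Hd] = 1 := by
        rw [hom_one_def, Category.assoc, HopfObj.one_antipode]
      rw [pair_doubleRightAction, hS, unitBracket_one_right, one_mul, mul_one]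
    have h {W : C} [ComonObj W] (w : W ⟶ H) :
        pair w (1 : W ⟶ Hd) = w ≫ (ρ_ H).inv ≫ H ◁ η[Hd] := by
      rw [← Category.assoc, comp_rightUnitor_inv, pair_whiskerLeft]; rfl
    rw [h, Category.id_comp] at e
    rw [h, Category.assoc, e, Category.comp_id]
  mul_act u v f _ _ := by
    have e : μ[H] ▷ Hd ≫ doubleRightAction H Hd = (H ⊗ H) ◁ Δ[Hd] ≫ tensorμ H H Hd Hd ≫
        (doubleRightAction H Hd ⊗ₘ doubleRightAction H Hd) ≫ μ[H] := by
      refine ext_tensor fun w f _ _ _ => ?_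
      rw [eq_pair_comp_fst_snd w, pair_whiskerLeft_assoc, comp_comul, pair_tensorμ_assoc,
        pair_tensorHom_assoc, pair_whiskerRight_assoc]
      exact mul_pair_doubleRightAction ..
    have e' := pair (pair u v) f ≫= e
    rwa [pair_whiskerLeft_assoc, comp_comul, pair_tensorμ_assoc, pair_tensorHom_assoc,
      pair_whiskerRight_assoc] at e'
  one_act f _ := by
    rw [pair_doubleRightAction, unitBracket_one_left, unitBracket_one_left, one_mul, one_mul]

end

end Action

end HopfBraces

theorem corollary2p17 {C : Type u} [Category.{v} C] [MonoidalCategory C]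
    [SymmetricCategory C] (H Hd : C) [HopfObj H] [IsCommMonObj H] [ExactPairing Hd H] :
    HopfBraces.IsHopfBrace (HopfBraces.drinfeldDouble H Hd) (HopfBraces.tensorDouble H Hd) := by
  let hd := HopfBraces.dualHopfObj H Hd
  have : HopfBraces.IsDualHopf H Hd := ⟨rfl⟩
  have : IsCommComonObj Hd := HopfBraces.isCommComonObj_dual (H := H)
  have hD := HopfBraces.isSmash_bicrossed (A := Hd) (HopfBraces.doubleRightAction H Hd)
  rw [← HopfBraces.doubleLeftAction_eq_snd] at hD
  -- The structure morphisms of `hd` are by definition those of `dualCop H Hd`, so both smash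
  -- products are definitionally the two doubles.
  exact hD.isHopfBrace HopfBraces.isModuleBimon_doubleRightAction
    (HopfBraces.isModuleBimon_fst Hd H) (HopfBraces.isSmash_tensor Hd H)
    fun u f _ => HopfBraces.pair_fst u f
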